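/- Let $G=(\mathcal X,\Sigma,P)$ be a context-free grammar with a finite set $\mathcal X$ of $n$ variables, a finite alphabet $\Sigma$ and a finite set $P$ of rules, let $X\in\mathcal X$, and let $k\ge 1$ be an integer. *Commutative ambiguity.* An $X$-tree is a finite ordered derivation tree whose root is labelled by a rule $X\to u_0X_1u_1\cdots X_ru_r$ ($u_i\in\Sigma^*$, $X_i\in\mathcal X$) and whose $i$-th child is an $X_i$-tree; its yield is $u_0w_1u_1\cdots w_ru_r$, where $w_i$ is the yield of the $i$-th child. For $v\in\mathbb N^\Sigma$ let $\mathrm{camb}_{X}(v)\in\mathbb N\cup\{\infty\}$ be the number of $X$-trees whose yield has Parikh vector $v$ (the vector of the numbers of occurrences of the letters). *Unfolding.* For $d\in\mathbb N$ the grammar $G^{\le d}$ over $\Sigma$ has the variables $Y^{\le e},Y^{=e}$ ($Y\in\mathcal X$, $0\le e\le d$) and exactly the following rules: (a) $Y^{\le e}\to Y^{=e'}$ for $0\le e'\le e\le d$; (b) $Y^{=0}\to u_0$ for each rule $Y\to u_0$ of $G$ with $u_0\in\Sigma^*$; (c) $Y^{=e}\to u_0X_1^{=e}u_1$ for each rule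 $Y\to u_0X_1u_1$ of $G$ and $0\le e\le d$; (d) for each rule $Y\to u_0X_1u_1\cdots X_ru_r$ of $G$ with $r>1$ and each $1\le e\le d$, the rules $Y^{=e}\to u_0Z_1u_1\cdots Z_ru_r$ where either, for some $j$, $Z_j=X_j^{=e}$ and $Z_i=X_i^{\le e-1}$ for all $i\ne j$; or, for some $J\subseteq\{1,\dots,r\}$ with $|J|\ge2$, $Z_i=X_i^{=e-1}$ for $i\in J$ and $Z_i=X_i^{\le e-2}$ for $i\notin J$, provided that all these variables are defined (that is, $e\ge2$ or $J=\{1,\dots,r\}$). Write $\mathrm{camb}_{X^{\le d}}$ for the commutative ambiguity of the variable $X^{\le d}$ in the grammar $G^{\le d}$. *Series modulo $k=k+1$.* Let $\mathbb N_k=\{0,1,\dots,k\}$ be the semiring with the addition and multiplication of $\mathbb N$ cut off at $k$ (so $k$ plays the role of $\infty$), and let $\mathbb N_k\langle\langle\mathbb N^\Sigma\rangle\rangle$ be the semiring of all functions $\mathbb N^\Sigma\to\mathbb N_k$ with pointwise addition and the Cauchy product. Functions $\mathbb N^\Sigma\to\mathbb N\cup\{\infty\}$ are viewed in it by applying $x\mapsto\min(x,k)$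 to each value. A series in $\mathbb N_k\langle\langle\mathbb N^\Sigma\rangle\rangle$ is rational if it is obtained from elements of $\mathbb N_k$ and of $\mathbb N^\Sigma$ by finitely many applications of addition, multiplication and Kleene star $a^*=\sum_{i\in\mathbb N}a^i$ (the supremum of the partial sums in the natural order). Put $\ell(k)=\lceil\log_2\log_2k\rceil$ for $k\ge2$ and $\ell(1)=0$. Then in $\mathbb N_k\langle\langle\mathbb N^\Sigma\rangle\rangle$ $$\mathrm{camb}_{X^{\le n+\ell(k)}}=\mathrm{camb}_X ,$$ and $\mathrm{camb}_X$ is rational in $\mathbb N_k\langle\langle\mathbb N^\Sigma\rangle\rangle$. -/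

import Mathlib

/-! ### The collapsed natural numbers -/

/-- The set `ℕ_k = {0, 1, …, k}` of natural numbers collapsed at `k`. -/
def CollapsedNat (k : ℕ) : Type := {n : ℕ // n ≤ k}

namespace CollapsedNat

/-- The projection `ℕ → ℕ_k`, which identifies all numbers `≥ k` with `k`. -/
def ofNat (k n : ℕ) : CollapsedNat k := ⟨min n k, min_le_right n k⟩

/-- The projection `ℕ ∪ {∞} → ℕ_k`, which identifies `∞` and all numbers `≥ k` with `k`. -/
noncomputable def ofENat (k : ℕ) (x : ℕ∞) : CollapsedNat k := ofNat k (min x (k : ℕ∞)).toNat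

instance (k : ℕ) : Zero (CollapsedNat k) := ⟨ofNat k 0⟩
instance (k : ℕ) : One (CollapsedNat k) := ⟨ofNat k 1⟩
instance (k : ℕ) : Add (CollapsedNat k) := ⟨fun a b => ofNat k (a.1 + b.1)⟩
instance (k : ℕ) : Mul (CollapsedNat k) := ⟨fun a b => ofNat k (a.1 * b.1)⟩
instance (k : ℕ) : SMul ℕ (CollapsedNat k) := ⟨fun n a => ofNat k (n * a.1)⟩
instance (k : ℕ) : Pow (CollapsedNat k) ℕ := ⟨fun a n => ofNat k (a.1 ^ n)⟩
instance (k : ℕ) : NatCast (CollapsedNat k) := ⟨ofNat k⟩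

theorem ofNat_surjective (k : ℕ) : Function.Surjective (ofNat k) := fun a =>
  ⟨a.1, Subtype.ext (min_eq_left a.2)⟩

theorem ofNat_add (k m n : ℕ) : ofNat k (m + n) = ofNat k m + ofNat k n := by
  apply Subtype.ext
  change min (m + n) k = min (min m k + min n k) k
  omega

theorem min_mul_min (k m n : ℕ) : min (m * n) k = min (min m k * min n k) k := by
  rcases Nat.eq_zero_or_pos m with rfl | hm
  · simp
  rcases Nat.eq_zero_or_pos n with rfl | hn
  · simp
  rcases le_total m k with h | h <;> rcases le_total n k with h' | h'
  · rw [min_eq_left h, min_eq_left h']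
  · rw [min_eq_left h, min_eq_right h', min_eq_right, min_eq_right] <;> nlinarith
  · rw [min_eq_right h, min_eq_left h', min_eq_right, min_eq_right] <;> nlinarith
  · rw [min_eq_right h, min_eq_right h', min_eq_right (by nlinarith)]
    rcases Nat.eq_zero_or_pos k with rfl | hk
    · simp
    · rw [min_eq_right]; nlinarith

theorem ofNat_mul (k m n : ℕ) : ofNat k (m * n) = ofNat k m * ofNat k n :=
  Subtype.ext (min_mul_min k m n)

theorem ofNat_nsmul (k n m : ℕ) : ofNat k (n • m) = n • ofNat k m := by
  apply Subtype.ext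
  change min (n * m) k = min (n * min m k) k
  rw [min_mul_min k n m, min_mul_min k n (min m k), min_eq_left (min_le_right m k)]

theorem ofNat_pow (k m n : ℕ) : ofNat k (m ^ n) = ofNat k m ^ n := by
  apply Subtype.ext
  change min (m ^ n) k = min (min m k ^ n) k
  induction n with
  | zero => simp
  | succ n ih =>
    rw [pow_succ, pow_succ, min_mul_min, ih, min_mul_min k (min m k ^ n) (min m k),
      min_eq_left (min_le_right m k)]

/-- Addition and multiplication on `ℕ_k` are those of `ℕ`, cut off at `k`; in other words
`k` plays the role of `∞`. -/
instance (k : ℕ) : CommSemiring (CollapsedNat k) :=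
  (ofNat_surjective k).commSemiring (ofNat k) rfl rfl (ofNat_add k) (ofNat_mul k)
    (fun n x => ofNat_nsmul k n x) (fun x n => ofNat_pow k x n) (fun _ => rfl)

end CollapsedNat

/-! ### Kleene star and rational power series -/

/-- The natural preorder of a semiring: `a` is below `b` if `a + d = b` for some `d`. -/
def NaturalLE {S : Type*} [Semiring S] (a b : S) : Prop := ∃ d, a + d = b

/-- `s` is the Kleene star `a* = ∑_{i ∈ ℕ} a ^ i`, i.e. the supremum of the partial sums with
respect to the natural order. -/
def IsKleeneStar {S : Type*} [Semiring S] (a s : S) : Prop :=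
  (∀ n : ℕ, NaturalLE (∑ i ∈ Finset.range n, a ^ i) s) ∧
    ∀ u : S, (∀ n : ℕ, NaturalLE (∑ i ∈ Finset.range n, a ^ i) u) → NaturalLE s u

/-- Rational power series in `R⟨⟨ℕ^σ⟩⟩` (with the Cauchy product): those obtained from the
elements of `R` and of the monoid `ℕ^σ` by addition, multiplication and Kleene star. -/
inductive IsRationalSeries {σ R : Type*} [CommSemiring R] : MvPowerSeries σ R → Prop
  | const (c : R) : IsRationalSeries (MvPowerSeries.C c)
  | monom (v : σ →₀ ℕ) : IsRationalSeries (MvPowerSeries.monomial v (1 : R))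
  | add {a b : MvPowerSeries σ R} :
      IsRationalSeries a → IsRationalSeries b → IsRationalSeries (a + b)
  | mul {a b : MvPowerSeries σ R} :
      IsRationalSeries a → IsRationalSeries b → IsRationalSeries (a * b)
  | star {a s : MvPowerSeries σ R} :
      IsRationalSeries a → IsKleeneStar a s → IsRationalSeries s

/-! ### Derivation trees and commutative ambiguity -/

/-- The list `X₁, …, X_r` of the variables occurring in `γ = u₀ X₁ u₁ … X_r u_r`. -/
def varsOf {T N : Type*} : List (Symbol T N) → List N
  | [] => []
  | Symbol.terminal _ :: γ => varsOf γ
  | Symbol.nonterminal X :: γ => X :: varsOf γ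

/-- For `γ = u₀ X₁ u₁ … X_r u_r`, the list `u₀ w₁ u₁ … w_r u_r`, with the letters of the words
`u_i` mapped by `f`. -/
def plugIn {T N β : Type*} (f : T → β) :
    (γ : List (Symbol T N)) → (Fin (varsOf γ).length → List β) → List β
  | [], _ => []
  | Symbol.terminal a :: γ, w => f a :: plugIn f γ w
  | Symbol.nonterminal _ :: γ, w =>
      w ⟨0, Nat.succ_pos _⟩ ++ plugIn f γ (fun i => w i.succ)

/-- The derivation trees `σ_{X,γ} t₁ … t_r` of a context-free grammar, indexed by the variable `X`
that is rewritten at the root: a node is a rule `X → u₀ X₁ u₁ … X_r u_r` and its `i`-th child is a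
derivation tree for `X_i`. -/
inductive DerivTree {T : Type*} (G : ContextFreeGrammar T) : G.NT → Type _
  | node (r : ContextFreeRule T G.NT) (hr : r ∈ G.rules)
      (t : (i : Fin (varsOf r.output).length) → DerivTree G ((varsOf r.output).get i)) :
      DerivTree G r.input

/-- The word represented by a derivation tree. -/
def DerivTree.yield {T : Type*} {G : ContextFreeGrammar T} : {X : G.NT} → DerivTree G X → List T
  | _, .node r _ t => plugIn id r.output (fun i => (t i).yield)

/-- The Parikh vector of a word: it counts the occurrences of every letter. -/
noncomputable def parikhVector {T : Type*} (w : List T) : T →₀ ℕ :=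
  (w.map (fun a => Finsupp.single a 1)).sum

/-- The commutative ambiguity of `(G, X)`, as a power series in `(ℕ ∪ {∞})⟨⟨ℕ^T⟩⟩`: it assigns to
`v` the number of `X`-trees whose yield has Parikh vector `v`. -/
noncomputable def camb {T : Type*} (G : ContextFreeGrammar T) (X : G.NT) : MvPowerSeries T ℕ∞ :=
  fun v => {t : DerivTree G X | parikhVector t.yield = v}.encard

/-- The commutative ambiguity of `(G, X)` in `ℕ_k⟨⟨ℕ^T⟩⟩`. -/
noncomputable def cambMod {T : Type*} (k : ℕ) (G : ContextFreeGrammar T) (X : G.NT) :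
    MvPowerSeries T (CollapsedNat k) :=
  fun v => CollapsedNat.ofENat k (camb G X v)

/-! ### Unfolding a grammar -/

/-- The variables `X^{≤ d}` and `X^{= d}` (`X ∈ N`, `0 ≤ d ≤ k`) of the `k`-th unfolding. -/
inductive UnfoldVar (N : Type) (k : ℕ) : Type
  | atMost (X : N) (d : Fin (k + 1)) : UnfoldVar N k
  | exactly (X : N) (d : Fin (k + 1)) : UnfoldVar N k

/-- For `γ = u₀ X₁ u₁ … X_r u_r`, the list `u₀ Z₁ u₁ … Z_r u_r`. -/
def relabel {T N N' : Type*} (γ : List (Symbol T N)) (Z : Fin (varsOf γ).length → N') :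
    List (Symbol T N') :=
  plugIn Symbol.terminal γ (fun i => [Symbol.nonterminal (Z i)])

open UnfoldVar in
/-- The rules of the `k`-th unfolding of a set `P` of context-free rules. -/
inductive UnfoldRule {T : Type*} {N : Type} (P : Finset (ContextFreeRule T N)) (k : ℕ) :
    ContextFreeRule T (UnfoldVar N k) → Prop
  /-- `X^{≤ d} → X^{= e}` for `e ≤ d`. -/
  | choose (X : N) (d e : Fin (k + 1)) (h : e ≤ d) :
      UnfoldRule P k ⟨atMost X d, [Symbol.nonterminal (exactly X e)]⟩
  /-- `X^{= 0} → u₀` for every rule `X → u₀`. -/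
  | leaf (r : ContextFreeRule T N) (hr : r ∈ P) (h : (varsOf r.output).length = 0) :
      UnfoldRule P k
        ⟨exactly r.input 0, relabel r.output (fun i => exactly ((varsOf r.output).get i) 0)⟩
  /-- `X^{= d} → u₀ X₁^{= d} u₁` for every rule `X → u₀ X₁ u₁`. -/
  | unary (r : ContextFreeRule T N) (hr : r ∈ P) (h : (varsOf r.output).length = 1)
      (d : Fin (k + 1)) :
      UnfoldRule P k
        ⟨exactly r.input d, relabel r.output (fun i => exactly ((varsOf r.output).get i) d)⟩
  /-- `X^{= d} → u₀ Z₁ u₁ … Z_r u_r` for every rule `X → u₀ X₁ u₁ … X_r u_r` with `r > 1`,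
  every `1 ≤ d ≤ k` and every `j`, where `Z_j = X_j^{= d}` and `Z_i = X_i^{≤ d - 1}` for `i ≠ j`. -/
  | single (r : ContextFreeRule T N) (hr : r ∈ P) (h : 1 < (varsOf r.output).length)
      (d e : Fin (k + 1)) (hd : (e : ℕ) + 1 = d) (j : Fin (varsOf r.output).length) :
      UnfoldRule P k
        ⟨exactly r.input d, relabel r.output (fun i =>
          if i = j then exactly ((varsOf r.output).get i) d
          else atMost ((varsOf r.output).get i) e)⟩
  /-- `X^{= d} → u₀ Z₁ u₁ … Z_r u_r` for every rule `X → u₀ X₁ u₁ … X_r u_r` with `r > 1`,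
  every `1 ≤ d ≤ k` and every set `J` of at least two indices, where `Z_i = X_i^{= d - 1}` for
  `i ∈ J` and `Z_i = X_i^{≤ d - 2}` for `i ∉ J`, provided that all `Z_i` are defined. -/
  | multi (r : ContextFreeRule T N) (hr : r ∈ P) (h : 1 < (varsOf r.output).length)
      (d : Fin (k + 1)) (J : Finset (Fin (varsOf r.output).length)) (hJ : 2 ≤ J.card)
      (Z : Fin (varsOf r.output).length → UnfoldVar N k)
      (hZ : ∀ i ∈ J, ∃ e : Fin (k + 1), (e : ℕ) + 1 = d ∧
        Z i = exactly ((varsOf r.output).get i) e)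
      (hZ' : ∀ i ∉ J, ∃ e : Fin (k + 1), (e : ℕ) + 2 = d ∧
        Z i = atMost ((varsOf r.output).get i) e) :
      UnfoldRule P k ⟨exactly r.input d, relabel r.output Z⟩

instance UnfoldVar.instFinite (N : Type) [Finite N] (k : ℕ) : Finite (UnfoldVar N k) := by
  refine Finite.of_surjective (α := (N × Fin (k + 1)) ⊕ (N × Fin (k + 1)))
    (Sum.elim (fun p => .atMost p.1 p.2) (fun p => .exactly p.1 p.2)) ?_
  rintro (⟨X, d⟩ | ⟨X, d⟩)
  · exact ⟨Sum.inl (X, d), rfl⟩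
  · exact ⟨Sum.inr (X, d), rfl⟩

theorem finite_setOf_unfoldRule {T : Type*} {N : Type} [Finite N]
    (P : Finset (ContextFreeRule T N)) (k : ℕ) : {s | UnfoldRule P k s}.Finite := by
  let A : Set (ContextFreeRule T (UnfoldVar N k)) :=
    Set.range (fun p : UnfoldVar N k × UnfoldVar N k => ⟨p.1, [Symbol.nonterminal p.2]⟩)
  let B : P → Set (ContextFreeRule T (UnfoldVar N k)) := fun r =>
    Set.range (fun p : UnfoldVar N k × (Fin (varsOf r.1.output).length → UnfoldVar N k) =>
      ⟨p.1, relabel r.1.output p.2⟩)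
  have hfin : (A ∪ ⋃ r, B r).Finite :=
    (Set.finite_range _).union (Set.finite_iUnion fun r => Set.finite_range _)
  refine hfin.subset ?_
  rintro _ (⟨X, d, e, h⟩ | ⟨r, hr, h⟩ | ⟨r, hr, h, d⟩ | ⟨r, hr, h, d, e, hd, j⟩ |
    ⟨r, hr, h, d, J, hJ, Z, hZ, hZ'⟩)
  · exact Or.inl ⟨(_, _), rfl⟩
  all_goals exact Or.inr (Set.mem_iUnion.2 ⟨⟨r, hr⟩, ⟨(_, _), rfl⟩⟩)

/-- The `k`-th unfolding `G^{≤ k}` of a context-free grammar `G`. -/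
noncomputable def unfoldGrammar {T : Type*} (G : ContextFreeGrammar T) [Finite G.NT] (k : ℕ) :
    ContextFreeGrammar T where
  NT := UnfoldVar G.NT k
  initial := UnfoldVar.atMost G.initial (Fin.last k)
  rules := (finite_setOf_unfoldRule G.rules k).toFinset

/-- The commutative ambiguity of `X^{≤ d}` in the grammar `G^{≤ d}`, in `ℕ_k⟨⟨ℕ^T⟩⟩`. -/
noncomputable def cambModAtMost {T : Type*} (k : ℕ) (G : ContextFreeGrammar T) [Finite G.NT]
    (X : G.NT) (d : ℕ) : MvPowerSeries T (CollapsedNat k) :=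
  cambMod k (unfoldGrammar G d) (UnfoldVar.atMost X (Fin.last d))

/-- `log log k` to base `2`, rounded up to a natural number; it is `0` for `k = 1` and `k = 2`. -/
noncomputable def logLog (k : ℕ) : ℕ := ⌈Real.logb 2 (Real.logb 2 (k : ℝ))⌉₊

/-! Trees are measured by their dimension (Strahler number). The unfolding is designed so that its
coefficients for `X^{≤ d}` count the `X`-trees of dimension at most `d` (`cambMod_unfoldGrammar`).
It remains to see that dimension `n + ℓ(k)` suffices modulo `k`, and that each dimension contributes
a rational series.

Bounded dimension. A tree may be rearranged as long as its multiset of rules is kept, since this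
multiset determines the Parikh vector. If the dimension is at least the number of variables
occurring in the tree, some variable recurs on a path, and the segment between the two occurrences
(a pump) can be moved to any tree containing that variable (`exists_pump`, `exists_move`). Gathering
pumps in one child brings the dimension down to the number of variables. A tree above that bound
even has two such rearrangements, because either of two critical children can receive the pumps
(`exists_two`). A tree of dimension above `n + m`, with `m > 0`, contains two siblings of dimension
exactly `n + m`, whose variants combine independently. The count therefore squares with each `m`,
giving `2 ^ 2 ^ m` variants of dimension at most `n + m` (`hasManyVariants`). With `m = ℓ(k)`, a
Parikh vector reached by a tree of larger dimension already has at least `k` trees of small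
dimension, so both coefficients equal `k`.

Rationality. At a node of dimension `e` at most one child has dimension `e`. The series for
dimension `e` thus form the least solution of a linear system over the series of smaller dimensions,
and elimination with Kleene stars solves it (`isRationalSeries_dimSeries`).

Counting series are compared through leastness: they lie below every family that satisfies their
polynomial system with `≤` (`treeSeries_naturalLE`). -/

noncomputable section

open scoped Classical

/-! ### The dimension of derivation trees -/

/-- The Strahler number of a node whose children have the Strahler numbers `δ i`. -/
def strahler {n : ℕ} (δ : Fin n → ℕ) : ℕ :=
  if 2 ≤ (Finset.univ.filter fun i => δ i = Finset.univ.sup δ).card then Finset.univ.sup δ + 1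
  else Finset.univ.sup δ

/-- This is the working form of the definition: a bound `D` fails only through a child above `D` or
through two children at `D`. -/
theorem strahler_le_iff {n : ℕ} (δ : Fin n → ℕ) (D : ℕ) :
    strahler δ ≤ D ↔ (∀ i, δ i ≤ D) ∧ ∀ i j, δ i = D → δ j = D → i = j := by
  unfold strahler
  have hle : ∀ i, δ i ≤ Finset.univ.sup δ := fun i => Finset.le_sup (Finset.mem_univ i)
  have hsup : ∀ D, Finset.univ.sup δ ≤ D ↔ ∀ i, δ i ≤ D := fun D => by simp
  split_ifs with h
  · obtain ⟨i, hi, j, hj, hij⟩ := Finset.one_lt_card.1 h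
    simp only [Finset.mem_filter, Finset.mem_univ, true_and] at hi hj
    constructor
    · intro hD
      refine ⟨fun l => (hle l).trans (by omega), fun a b ha => ?_⟩
      have := hle a
      omega
    · rintro ⟨h1, h2⟩
      have h3 := (hsup D).2 h1
      rcases h3.lt_or_eq with h4 | h4
      · exact h4
      · exact absurd (h2 i j (by omega) (by omega)) hij
  · rw [hsup]
    refine ⟨fun h1 => ⟨h1, fun i j hi hj => ?_⟩, fun h1 => h1.1⟩
    by_contra hij
    have hD : Finset.univ.sup δ = D := le_antisymm ((hsup D).2 h1) (hi ▸ hle i)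
    apply h
    refine Finset.one_lt_card.2 ⟨i, ?_, j, ?_, hij⟩ <;> simp [hD, hi, hj]

theorem le_strahler {n : ℕ} (δ : Fin n → ℕ) (i : Fin n) : δ i ≤ strahler δ :=
  ((strahler_le_iff δ _).1 le_rfl).1 i

/-- The variables that are rewritten by a multiset of rules. -/
def inputs {T N : Type*} (m : Multiset (ContextFreeRule T N)) : Finset N :=
  (m.map ContextFreeRule.input).toFinset

theorem mem_inputs {T N : Type*} {m : Multiset (ContextFreeRule T N)} {Y : N} :
    Y ∈ inputs m ↔ ∃ r ∈ m, r.input = Y := by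
  simp [inputs]

theorem inputs_add {T N : Type*} (m m' : Multiset (ContextFreeRule T N)) :
    inputs (m + m') = inputs m ∪ inputs m' := by
  simp [inputs]

theorem inputs_mono {T N : Type*} {m m' : Multiset (ContextFreeRule T N)} (h : m ≤ m') :
    inputs m ⊆ inputs m' := by
  intro Y hY
  obtain ⟨r, hr, rfl⟩ := mem_inputs.1 hY
  exact mem_inputs.2 ⟨r, Multiset.mem_of_le h hr, rfl⟩

namespace DerivTree

variable {T : Type*} {G : ContextFreeGrammar T}

/-- The multiset of rules at the nodes of a derivation tree. -/
def ruleMultiset : {X : G.NT} → DerivTree G X → Multiset (ContextFreeRule T G.NT)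
  | _, .node r _ t => {r} + ∑ i, (t i).ruleMultiset

/-- The dimension (Strahler number) of a derivation tree. -/
def dim : {X : G.NT} → DerivTree G X → ℕ
  | _, .node _ _ t => strahler fun i => (t i).dim

theorem ruleMultiset_node (r : ContextFreeRule T G.NT) (hr : r ∈ G.rules)
    (f : ∀ i : Fin (varsOf r.output).length, DerivTree G ((varsOf r.output).get i)) :
    (node r hr f).ruleMultiset = {r} + ∑ i, (f i).ruleMultiset := rfl

theorem dim_node (r : ContextFreeRule T G.NT) (hr : r ∈ G.rules)
    (f : ∀ i : Fin (varsOf r.output).length, DerivTree G ((varsOf r.output).get i)) :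
    (node r hr f).dim = strahler fun i => (f i).dim := rfl

/-- The exchanged trees appear on opposite sides to avoid truncated subtraction of multisets. -/
theorem sum_ruleMultiset_update {n : ℕ} {X : Fin n → G.NT} (f : ∀ i, DerivTree G (X i)) (i : Fin n)
    (u : DerivTree G (X i)) :
    ∑ l, (Function.update f i u l).ruleMultiset + (f i).ruleMultiset =
      ∑ l, (f l).ruleMultiset + u.ruleMultiset := by
  rw [← Finset.add_sum_erase _ _ (Finset.mem_univ i), ← Finset.add_sum_erase _ (fun l =>
    (f l).ruleMultiset) (Finset.mem_univ i), Function.update_self]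
  have : ∑ l ∈ Finset.univ.erase i, (Function.update f i u l).ruleMultiset =
      ∑ l ∈ Finset.univ.erase i, (f l).ruleMultiset :=
    Finset.sum_congr rfl fun l hl => by rw [Function.update_of_ne (Finset.ne_of_mem_erase hl)]
  rw [this]
  abel

theorem ruleMultiset_le_sum {n : ℕ} {X : Fin n → G.NT} (f : ∀ i, DerivTree G (X i)) (i : Fin n) :
    (f i).ruleMultiset ≤ ∑ l, (f l).ruleMultiset := by
  rw [← Finset.add_sum_erase _ _ (Finset.mem_univ i)]
  exact Multiset.le_add_right _ _

theorem ruleMultiset_le_node (r : ContextFreeRule T G.NT) (hr : r ∈ G.rules)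
    (f : ∀ i : Fin (varsOf r.output).length, DerivTree G ((varsOf r.output).get i)) (i) :
    (f i).ruleMultiset ≤ (node r hr f).ruleMultiset :=
  (ruleMultiset_le_sum f i).trans (Multiset.le_add_left _ _)

theorem card_ruleMultiset_lt_node (r : ContextFreeRule T G.NT) (hr : r ∈ G.rules)
    (f : ∀ i : Fin (varsOf r.output).length, DerivTree G ((varsOf r.output).get i)) :
    (∑ i, (f i).ruleMultiset).card < (node r hr f).ruleMultiset.card := by
  rw [ruleMultiset_node, Multiset.card_add, Multiset.card_singleton]
  omega

theorem mem_inputs_node {r : ContextFreeRule T G.NT} {hr : r ∈ G.rules}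
    {f : ∀ i : Fin (varsOf r.output).length, DerivTree G ((varsOf r.output).get i)} {Y : G.NT} :
    Y ∈ inputs (node r hr f).ruleMultiset ↔
      Y = r.input ∨ ∃ i, Y ∈ inputs (f i).ruleMultiset := by
  simp only [mem_inputs, ruleMultiset_node, Multiset.mem_add, Multiset.mem_singleton,
    Multiset.mem_sum, Finset.mem_univ, true_and]
  constructor
  · rintro ⟨s, rfl | ⟨i, hi⟩, rfl⟩
    · exact Or.inl rfl
    · exact Or.inr ⟨i, s, hi, rfl⟩
  · rintro (rfl | ⟨i, s, hi, rfl⟩)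
    · exact ⟨r, Or.inl rfl, rfl⟩
    · exact ⟨s, Or.inr ⟨i, hi⟩, rfl⟩

/-! ### Pumping -/

/-- `ε` collects the rules outside one subtree rooted at `Y`; this context survives any replacement
of the subtree. -/
theorem exists_subtree {X : G.NT} (t : DerivTree G X) {Y : G.NT}
    (hY : Y ∈ inputs t.ruleMultiset) :
    ∃ (s : DerivTree G Y) (ε : Multiset (ContextFreeRule T G.NT)),
      t.ruleMultiset = s.ruleMultiset + ε ∧
        ∀ s' : DerivTree G Y, ∃ t' : DerivTree G X, t'.ruleMultiset = s'.ruleMultiset + ε := by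
  induction t with
  | node r hr f ih =>
    rcases mem_inputs_node.1 hY with rfl | ⟨i, hi⟩
    · exact ⟨node r hr f, 0, by simp, fun s' => ⟨s', by simp⟩⟩
    · obtain ⟨s, ε, h1, h2⟩ := ih i hi
      refine ⟨s, ε + ({r} + ∑ l ∈ Finset.univ.erase i, (f l).ruleMultiset), ?_, fun s' => ?_⟩
      · rw [ruleMultiset_node, ← Finset.add_sum_erase _ _ (Finset.mem_univ i), h1]
        abel
      · obtain ⟨t', ht'⟩ := h2 s'
        refine ⟨node r hr (Function.update f i t'), ?_⟩
        have h3 := sum_ruleMultiset_update f i t'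
        rw [← Finset.add_sum_erase _ (fun l => (f l).ruleMultiset) (Finset.mem_univ i)] at h3
        rw [ruleMultiset_node]
        apply add_right_cancel (b := (f i).ruleMultiset)
        rw [add_assoc, h3, ht']
        abel

/-- The rules in `δ` can be inserted into every derivation tree for `Y`. -/
def IsPump (G : ContextFreeGrammar T) (Y : G.NT) (δ : Multiset (ContextFreeRule T G.NT)) : Prop :=
  ∀ s : DerivTree G Y, ∃ s' : DerivTree G Y, s'.ruleMultiset = s.ruleMultiset + δ

theorem IsPump.insert {Y : G.NT} {δ : Multiset (ContextFreeRule T G.NT)} (h : IsPump G Y δ)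
    {X : G.NT} (t : DerivTree G X) (hY : Y ∈ inputs t.ruleMultiset) :
    ∃ t' : DerivTree G X, t'.ruleMultiset = t.ruleMultiset + δ := by
  obtain ⟨s, ε, h1, h2⟩ := t.exists_subtree hY
  obtain ⟨s', hs'⟩ := h s
  obtain ⟨t', ht'⟩ := h2 s'
  refine ⟨t', ?_⟩
  rw [ht', hs', h1]
  abel

/-- Descend to a node none of whose children satisfies the hypothesis. If its variable did not recur
below it, every child would miss that variable, and the dimension would be too small. So the
variable recurs, and the segment between the two occurrences can be cut out and reinserted. -/
theorem exists_pump {X : G.NT} (t : DerivTree G X)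
    (ht : (inputs t.ruleMultiset).card ≤ t.dim) :
    ∃ (Y : G.NT) (δ : Multiset (ContextFreeRule T G.NT)) (t' : DerivTree G X), δ ≠ 0 ∧
      Y ∈ inputs t.ruleMultiset ∧ t.ruleMultiset = t'.ruleMultiset + δ ∧ IsPump G Y δ := by
  induction t with
  | node r hr f ih =>
    by_cases h : ∃ i, (inputs (f i).ruleMultiset).card ≤ (f i).dim
    · obtain ⟨i, hi⟩ := h
      obtain ⟨Y, δ, t', h0, h1, h2, h3⟩ := ih i hi
      refine ⟨Y, δ, node r hr (Function.update f i t'), h0, ?_, ?_, h3⟩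
      · exact inputs_mono (ruleMultiset_le_node r hr f i) h1
      · have h4 := sum_ruleMultiset_update f i t'
        rw [ruleMultiset_node, ruleMultiset_node]
        apply add_right_cancel (b := t'.ruleMultiset)
        rw [add_assoc, ← h4, h2]
        abel
    push Not at h
    by_cases hX : ∃ i, r.input ∈ inputs (f i).ruleMultiset
    · obtain ⟨i, hi⟩ := hX
      obtain ⟨s, ε, h1, h2⟩ := (f i).exists_subtree hi
      have key : ∀ u : DerivTree G ((varsOf r.output).get i),
          (node r hr (Function.update f i u)).ruleMultiset =
            u.ruleMultiset + ({r} + ∑ l ∈ Finset.univ.erase i, (f l).ruleMultiset) := by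
        intro u
        have h3 := sum_ruleMultiset_update f i u
        rw [← Finset.add_sum_erase _ (fun l => (f l).ruleMultiset) (Finset.mem_univ i)] at h3
        rw [ruleMultiset_node]
        apply add_right_cancel (b := (f i).ruleMultiset)
        rw [add_assoc, h3]
        abel
      -- The pump is everything outside the lower occurrence `s` of the root variable, and `s`
      -- itself is the tree left over.
      refine ⟨r.input, ε + ({r} + ∑ l ∈ Finset.univ.erase i, (f l).ruleMultiset), s, ?_, ?_, ?_,
        fun s' => ?_⟩
      · intro h0
        have := congrArg Multiset.card h0
        simp at this
      · exact mem_inputs_node.2 (Or.inl rfl)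
      · have := key (f i)
        rw [Function.update_eq_self, h1] at this
        rw [this]
        abel
      · obtain ⟨t', ht'⟩ := h2 s'
        refine ⟨node r hr (Function.update f i t'), ?_⟩
        rw [key, ht']
        abel
    · exfalso
      push Not at hX
      have hcard : ∀ i, (inputs (f i).ruleMultiset).card <
          (inputs (node r hr f).ruleMultiset).card := fun i => by
        refine Finset.card_lt_card ⟨inputs_mono (ruleMultiset_le_node r hr f i), fun hs => ?_⟩
        exact hX i (hs (mem_inputs_node.2 (Or.inl rfl)))
      have hpos : 0 < (inputs (node r hr f).ruleMultiset).card :=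
        Finset.card_pos.2 ⟨r.input, mem_inputs_node.2 (Or.inl rfl)⟩
      -- Two strict inequalities put each child at most at the cardinality minus two, so no child
      -- attains the bound and the uniqueness clause is vacuous.
      have hdim : (node r hr f).dim ≤ (inputs (node r hr f).ruleMultiset).card - 1 := by
        rw [dim_node, strahler_le_iff]
        refine ⟨fun i => ?_, fun i j hi => ?_⟩
        · have := h i; have := hcard i; omega
        · have := h i; have := hcard i; omega
      omega

/-! ### Compact trees -/

/-- A pump of the child `i` is moved to the child `j`. -/
theorem exists_move {n : ℕ} {X : Fin n → G.NT} (f : ∀ i, DerivTree G (X i)) {i j : Fin n}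
    (hij : i ≠ j) (hsub : ∀ l, inputs (f l).ruleMultiset ⊆ inputs (f j).ruleMultiset)
    (hi : (inputs (f j).ruleMultiset).card ≤ (f i).dim) :
    ∃ f' : ∀ i, DerivTree G (X i), ∑ l, (f' l).ruleMultiset = ∑ l, (f l).ruleMultiset ∧
      (∀ l, inputs (f' l).ruleMultiset ⊆ inputs (f' j).ruleMultiset) ∧
      inputs (f' j).ruleMultiset = inputs (f j).ruleMultiset ∧
      (∀ l, l ≠ j → (f' l).ruleMultiset ≤ (f l).ruleMultiset) ∧
      (f j).ruleMultiset < (f' j).ruleMultiset := by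
  obtain ⟨Y, δ, u, h0, h1, h2, h3⟩ :=
    (f i).exists_pump ((Finset.card_le_card (hsub i)).trans hi)
  obtain ⟨w, hw⟩ := h3.insert (f j) (hsub i h1)
  have hwi : inputs w.ruleMultiset = inputs (f j).ruleMultiset := by
    rw [hw, inputs_add, Finset.union_eq_left]
    refine (inputs_mono ?_).trans (hsub i)
    rw [h2]
    exact Multiset.le_add_left _ _
  have hle : ∀ l, l ≠ j →
      (Function.update (Function.update f i u) j w l).ruleMultiset ≤ (f l).ruleMultiset := by
    intro l hl
    rw [Function.update_of_ne hl]
    by_cases hli : l = i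
    · subst hli
      rw [Function.update_self, h2]
      exact Multiset.le_add_right _ _
    · rw [Function.update_of_ne hli]
  refine ⟨Function.update (Function.update f i u) j w, ?_, fun l => ?_, ?_, hle, ?_⟩
  · have e1 := sum_ruleMultiset_update (Function.update f i u) j w
    have e2 := sum_ruleMultiset_update f i u
    rw [Function.update_of_ne hij.symm, hw] at e1
    rw [h2] at e2
    apply add_right_cancel (b := (f j).ruleMultiset + u.ruleMultiset)
    rw [← add_assoc, e1]
    calc ∑ l, (Function.update f i u l).ruleMultiset + ((f j).ruleMultiset + δ) + u.ruleMultiset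
        = (f j).ruleMultiset +
            (∑ l, (Function.update f i u l).ruleMultiset + (u.ruleMultiset + δ)) := by abel
      _ = ∑ l, (f l).ruleMultiset + ((f j).ruleMultiset + u.ruleMultiset) := by
        rw [e2]
        abel
  · rw [Function.update_self, hwi]
    by_cases hl : l = j
    · subst hl
      rw [Function.update_self, hwi]
    · exact (inputs_mono (hle l hl)).trans (hsub l)
  · rw [Function.update_self, hwi]
  · rw [Function.update_self, hw]
    exact lt_add_of_pos_right _ (pos_iff_ne_zero.2 h0)

/-- Child `j` contains all variables of its siblings, so it can absorb any of their pumps. Make all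
children compact and, while a sibling is still too large, move one of its pumps to `j`; the number
`M` of rules outside `j` drops each time. The size bound `N` in `hcomp` lets the induction
hypothesis of `exists_two` be used here. -/
theorem exists_reduced_family {n : ℕ} {X : Fin n → G.NT} {N : ℕ}
    (hcomp : ∀ (Y : G.NT) (s : DerivTree G Y), s.ruleMultiset.card ≤ N →
      ∃ s' : DerivTree G Y, s'.ruleMultiset = s.ruleMultiset ∧
        s'.dim ≤ (inputs s.ruleMultiset).card)
    (j : Fin n) (M : ℕ) (f : ∀ i, DerivTree G (X i))
    (hM : M = ∑ i ∈ Finset.univ.erase j, (f i).ruleMultiset.card)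
    (hN : (∑ i, (f i).ruleMultiset).card ≤ N)
    (hsub : ∀ l, inputs (f l).ruleMultiset ⊆ inputs (f j).ruleMultiset) :
    ∃ f' : ∀ i, DerivTree G (X i), ∑ l, (f' l).ruleMultiset = ∑ l, (f l).ruleMultiset ∧
      (∀ l, l ≠ j → (f' l).ruleMultiset ≤ (f l).ruleMultiset) ∧
      (f j).ruleMultiset ≤ (f' j).ruleMultiset ∧
      (f' j).dim ≤ (inputs (f j).ruleMultiset).card ∧
      ∀ l, l ≠ j → (f' l).dim < (inputs (f j).ruleMultiset).card := by
  induction M using Nat.strong_induction_on generalizing f with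
  | _ M ih =>
    have hc : ∀ i, ∃ s' : DerivTree G (X i), s'.ruleMultiset = (f i).ruleMultiset ∧
        s'.dim ≤ (inputs (f i).ruleMultiset).card := fun i =>
      hcomp _ (f i) ((Multiset.card_le_card (ruleMultiset_le_sum f i)).trans hN)
    choose g hg hgd using hc
    by_cases h : ∀ l, l ≠ j → (g l).dim < (inputs (f j).ruleMultiset).card
    · exact ⟨g, by simp only [hg], fun l _ => (hg l).le, (hg j).ge, hgd j, h⟩
    push Not at h
    obtain ⟨i, hij, hi⟩ := h
    obtain ⟨f', e1, e2, e3, e4, e5⟩ := exists_move g hij (by simpa only [hg] using hsub)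
      (by simpa only [hg] using hi)
    simp only [hg] at e1 e3 e4 e5
    have hlt : ∑ l ∈ Finset.univ.erase j, (f' l).ruleMultiset.card < M := by
      have a1 := congrArg Multiset.card e1
      rw [Multiset.card_sum, Multiset.card_sum, ← Finset.add_sum_erase _ _ (Finset.mem_univ j),
        ← Finset.add_sum_erase _ (fun l => (f l).ruleMultiset.card) (Finset.mem_univ j), ← hM] at a1
      have a2 := Multiset.card_lt_card e5
      omega
    obtain ⟨f'', b1, b2, b3, b4, b5⟩ := ih _ hlt f' rfl (e1 ▸ hN) e2
    rw [e3] at b4 b5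
    exact ⟨f'', b1.trans e1, fun l hl => (b2 l hl).trans (e4 l hl), e5.le.trans b3, b4, b5⟩

/-- The dimension can be too large only because two children `i ≠ j` both have dimension `I.card`;
being compact, each contains every variable of `I`. Pumps can thus be gathered in `j` or in `i`, and
the two outcomes differ in the size of child `j`. -/
theorem exists_two_of_compact_children {N : ℕ}
    (hcomp : ∀ (Y : G.NT) (s : DerivTree G Y), s.ruleMultiset.card ≤ N →
      ∃ s' : DerivTree G Y, s'.ruleMultiset = s.ruleMultiset ∧
        s'.dim ≤ (inputs s.ruleMultiset).card)
    (r : ContextFreeRule T G.NT) (hr : r ∈ G.rules)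
    (f : ∀ i : Fin (varsOf r.output).length, DerivTree G ((varsOf r.output).get i))
    (hN : (∑ i, (f i).ruleMultiset).card ≤ N)
    (hf : ∀ i, (f i).dim ≤ (inputs (f i).ruleMultiset).card)
    (hdim : (inputs (node r hr f).ruleMultiset).card < (node r hr f).dim) :
    ∃ t₁ t₂ : DerivTree G r.input, t₁ ≠ t₂ ∧
      (t₁.ruleMultiset = (node r hr f).ruleMultiset ∧
        t₁.dim ≤ (inputs (node r hr f).ruleMultiset).card) ∧
      (t₂.ruleMultiset = (node r hr f).ruleMultiset ∧
        t₂.dim ≤ (inputs (node r hr f).ruleMultiset).card) := by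
  set I := inputs (node r hr f).ruleMultiset with hI
  have hsubI : ∀ i, inputs (f i).ruleMultiset ⊆ I := fun i =>
    inputs_mono (ruleMultiset_le_node r hr f i)
  have hle : ∀ i, (f i).dim ≤ I.card := fun i =>
    (hf i).trans (Finset.card_le_card (hsubI i))
  rw [dim_node, ← not_le, strahler_le_iff] at hdim
  obtain ⟨i, j, hi, hj, hij⟩ : ∃ i j, (f i).dim = I.card ∧ (f j).dim = I.card ∧ i ≠ j := by
    by_contra hcon
    push Not at hcon
    exact hdim ⟨hle, hcon⟩
  have hfull : ∀ i, (f i).dim = I.card → inputs (f i).ruleMultiset = I := fun i hi =>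
    Finset.eq_of_subset_of_card_le (hsubI i) (hi ▸ hf i)
  have main : ∀ i j, i ≠ j → (f i).dim = I.card → (f j).dim = I.card →
      ∃ f' : ∀ i : Fin (varsOf r.output).length, DerivTree G ((varsOf r.output).get i),
        (node r hr f').ruleMultiset = (node r hr f).ruleMultiset ∧
        (node r hr f').dim ≤ I.card ∧ (f' i).ruleMultiset ≤ (f i).ruleMultiset ∧
        (f j).ruleMultiset < (f' j).ruleMultiset := by
    intro i j hij hi hj
    obtain ⟨g, e1, e2, e3, e4, e5⟩ := exists_move f hij
      (fun l => (hfull j hj).symm ▸ hsubI l) (by rw [hfull j hj, hi])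
    obtain ⟨f', b1, b2, b3, b4, b5⟩ := exists_reduced_family hcomp j _ g rfl (e1 ▸ hN) e2
    rw [e3, hfull j hj] at b4 b5
    refine ⟨f', by rw [ruleMultiset_node, ruleMultiset_node, b1, e1], ?_,
      (b2 i hij).trans (e4 i hij), e5.trans_le b3⟩
    rw [dim_node, strahler_le_iff]
    refine ⟨fun l => ?_, fun a b ha hb => ?_⟩
    · by_cases hl : l = j
      · subst hl; exact b4
      · exact (b5 l hl).le
    · by_contra hab
      by_cases haj : a = j
      · subst haj
        exact (b5 b (Ne.symm hab)).ne hb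
      · exact (b5 a haj).ne ha
  obtain ⟨f₁, a1, a2, -, a4⟩ := main i j hij hi hj
  obtain ⟨f₂, c1, c2, c3, -⟩ := main j i hij.symm hj hi
  refine ⟨node r hr f₁, node r hr f₂, fun h => ?_, ⟨a1, a2⟩, c1, c2⟩
  -- Child `j` has strictly gained rules in `f₁` and gained none in `f₂`.
  have h' : f₁ = f₂ := by simpa using h
  rw [h'] at a4
  exact (a4.trans_le c3).false

/-- The induction is on the number of rules, because rearranged children are not subtrees of `t`.
The second tree is what starts the doubly exponential growth in `hasManyVariants`. -/
theorem exists_two {X : G.NT} (t : DerivTree G X)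
    (ht : (inputs t.ruleMultiset).card < t.dim) :
    ∃ t₁ t₂ : DerivTree G X, t₁ ≠ t₂ ∧
      (t₁.ruleMultiset = t.ruleMultiset ∧ t₁.dim ≤ (inputs t.ruleMultiset).card) ∧
      (t₂.ruleMultiset = t.ruleMultiset ∧ t₂.dim ≤ (inputs t.ruleMultiset).card) := by
  induction hm : t.ruleMultiset.card using Nat.strong_induction_on generalizing X t with
  | _ m ih =>
    have hcomp : ∀ (Y : G.NT) (s : DerivTree G Y), s.ruleMultiset.card ≤ m - 1 →
        ∃ s' : DerivTree G Y, s'.ruleMultiset = s.ruleMultiset ∧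
          s'.dim ≤ (inputs s.ruleMultiset).card := by
      intro Y s hs
      by_cases h : s.dim ≤ (inputs s.ruleMultiset).card
      · exact ⟨s, rfl, h⟩
      · have hpos : 0 < m := by
          rw [← hm]
          cases t with
          | node r hr f => exact (Nat.zero_le _).trans_lt (card_ruleMultiset_lt_node r hr f)
        obtain ⟨s', -, -, hs', -⟩ := ih _ (by omega) s (not_le.1 h) rfl
        exact ⟨s', hs'⟩
    cases t with
    | node r hr f =>
      have hlt := card_ruleMultiset_lt_node r hr f
      have hN : (∑ i, (f i).ruleMultiset).card ≤ m - 1 := by omega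
      have hsm : ∀ i, (f i).ruleMultiset.card ≤ m - 1 := fun i =>
        (Multiset.card_le_card (ruleMultiset_le_sum f i)).trans hN
      by_cases h : ∀ i, (f i).dim ≤ (inputs (f i).ruleMultiset).card
      · exact exists_two_of_compact_children hcomp r hr f hN h ht
      push Not at h
      obtain ⟨i, hi⟩ := h
      obtain ⟨u₁, u₂, hu, ⟨hu1, hd1⟩, hu2, hd2⟩ := ih _ (by have := hsm i; omega) (f i) hi rfl
      choose g hg hgd using fun l => hcomp _ (f l) (hsm l)
      have key : ∀ u : DerivTree G ((varsOf r.output).get i),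
          u.ruleMultiset = (f i).ruleMultiset → u.dim ≤ (inputs (f i).ruleMultiset).card →
          (∑ l, (Function.update g i u l).ruleMultiset = ∑ l, (f l).ruleMultiset) ∧
          ∀ l, (Function.update g i u l).dim ≤
            (inputs (Function.update g i u l).ruleMultiset).card := by
        intro u hu1 hu2
        refine ⟨?_, fun l => ?_⟩
        · have := sum_ruleMultiset_update g i u
          rw [hu1, hg i] at this
          simpa only [hg] using add_right_cancel this
        · by_cases hl : l = i
          · subst hl
            rw [Function.update_self, hu1]
            exact hu2
          · rw [Function.update_of_ne hl, hg l]
            exact hgd l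
      have done : ∀ u : DerivTree G ((varsOf r.output).get i),
          u.ruleMultiset = (f i).ruleMultiset → u.dim ≤ (inputs (f i).ruleMultiset).card →
          ¬ (node r hr (Function.update g i u)).dim ≤ (inputs (node r hr f).ruleMultiset).card →
          ∃ t₁ t₂ : DerivTree G r.input, t₁ ≠ t₂ ∧
            (t₁.ruleMultiset = (node r hr f).ruleMultiset ∧
              t₁.dim ≤ (inputs (node r hr f).ruleMultiset).card) ∧
            (t₂.ruleMultiset = (node r hr f).ruleMultiset ∧
              t₂.dim ≤ (inputs (node r hr f).ruleMultiset).card) := by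
        intro u h1 h2 h3
        obtain ⟨k1, k2⟩ := key u h1 h2
        have k3 : (node r hr (Function.update g i u)).ruleMultiset =
          (node r hr f).ruleMultiset := by rw [ruleMultiset_node, ruleMultiset_node, k1]
        have := exists_two_of_compact_children hcomp r hr _ (k1 ▸ hN) k2
          (by rw [k3]; exact not_le.1 h3)
        rwa [k3] at this
      -- Each variant of the bad child `i` is placed among compact siblings. Either both resulting
      -- nodes are compact, and they differ at `i`, or one of them is too large with compact
      -- children and itself yields two trees.
      by_cases h1 : (node r hr (Function.update g i u₁)).dim ≤
          (inputs (node r hr f).ruleMultiset).card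
      · by_cases h2 : (node r hr (Function.update g i u₂)).dim ≤
            (inputs (node r hr f).ruleMultiset).card
        · refine ⟨_, _, fun h => hu ?_, ⟨?_, h1⟩, ?_, h2⟩
          · have h' : Function.update g i u₁ = Function.update g i u₂ := by simpa using h
            simpa using congrFun h' i
          · rw [ruleMultiset_node, ruleMultiset_node, (key u₁ hu1 hd1).1]
          · rw [ruleMultiset_node, ruleMultiset_node, (key u₂ hu2 hd2).1]
        · exact done u₂ hu2 hd2 h2
      · exact done u₁ hu1 hd1 h1

theorem exists_compact {X : G.NT} (t : DerivTree G X) :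
    ∃ t' : DerivTree G X, t'.ruleMultiset = t.ruleMultiset ∧
      t'.dim ≤ (inputs t.ruleMultiset).card := by
  by_cases h : t.dim ≤ (inputs t.ruleMultiset).card
  · exact ⟨t, rfl, h⟩
  · obtain ⟨s', -, -, hs', -⟩ := t.exists_two (not_le.1 h)
    exact ⟨s', hs'⟩

/-! ### Many trees of small dimension -/

/-- There are at least `m` trees of dimension at most `D` with the same rules as `t`. -/
def HasManyVariants {X : G.NT} (t : DerivTree G X) (m D : ℕ) : Prop :=
  ∃ g : Fin m → DerivTree G X, Function.Injective g ∧
    ∀ a, (g a).ruleMultiset = t.ruleMultiset ∧ (g a).dim ≤ D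

theorem exists_dim_le_card [Fintype G.NT] {X : G.NT} (t : DerivTree G X) :
    ∃ t' : DerivTree G X, t'.ruleMultiset = t.ruleMultiset ∧ t'.dim ≤ Fintype.card G.NT := by
  obtain ⟨t', h1, h2⟩ := t.exists_compact
  exact ⟨t', h1, h2.trans (Finset.card_le_univ _)⟩

/-- For the step, go down to a node of too large a dimension whose children all respect the bound.
Two of them attain it, and their variants for `k` combine to the square of the previous number. -/
theorem hasManyVariants [Fintype G.NT] (k : ℕ) {X : G.NT} (t : DerivTree G X)
    (ht : Fintype.card G.NT + k < t.dim) :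
    t.HasManyVariants (2 ^ 2 ^ k) (Fintype.card G.NT + k) := by
  induction k generalizing X t with
  | zero =>
    have hc : (inputs t.ruleMultiset).card ≤ Fintype.card G.NT := Finset.card_le_univ _
    obtain ⟨t₁, t₂, hne, ⟨h1, h2⟩, h3, h4⟩ := t.exists_two (by omega)
    refine ⟨![t₁, t₂], ?_, ?_⟩
    · intro a b hab
      change Fin 2 at a b
      fin_cases a <;> fin_cases b <;> simp_all
    · intro a
      change Fin 2 at a
      fin_cases a
      · exact ⟨h1, h2.trans hc⟩
      · exact ⟨h3, h4.trans hc⟩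
  | succ k ihk =>
    induction t with
    | node r hr f ih =>
      choose c hc hcd using fun i => (f i).exists_dim_le_card
      by_cases h : ∃ i, Fintype.card G.NT + (k + 1) < (f i).dim
      · obtain ⟨i, hi⟩ := h
        obtain ⟨g, hg1, hg2⟩ := ih i hi
        refine ⟨fun a => node r hr (Function.update c i (g a)), fun a b hab => hg1 ?_, fun a => ?_⟩
        · have h' : Function.update c i (g a) = Function.update c i (g b) := by simpa using hab
          simpa using congrFun h' i
        · constructor
          · have := sum_ruleMultiset_update c i (g a)
            rw [(hg2 a).1, hc i] at this
            rw [ruleMultiset_node, add_right_cancel this, ruleMultiset_node]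
            simp only [hc]
          · rw [dim_node, strahler_le_iff]
            -- The siblings have been replaced by variants of dimension at most `Fintype.card G.NT`,
            -- so only child `i` can reach the bound.
            have hlt : ∀ l, l ≠ i →
                (Function.update c i (g a) l).dim < Fintype.card G.NT + (k + 1) := fun l hl => by
              rw [Function.update_of_ne hl]
              have := hcd l
              omega
            refine ⟨fun l => ?_, fun x y hx hy => ?_⟩
            · by_cases hl : l = i
              · subst hl
                rw [Function.update_self]
                exact (hg2 a).2
              · exact (hlt l hl).le
            · have hxi : x = i := by
                by_contra hxi
                exact (hlt x hxi).ne hx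
              have hyi : y = i := by
                by_contra hyi
                exact (hlt y hyi).ne hy
              rw [hxi, hyi]
      · push Not at h
        rw [dim_node, ← not_le, strahler_le_iff] at ht
        obtain ⟨i, j, hi, hj, hij⟩ : ∃ i j, (f i).dim = Fintype.card G.NT + (k + 1) ∧
            (f j).dim = Fintype.card G.NT + (k + 1) ∧ i ≠ j := by
          by_contra hcon
          push Not at hcon
          exact ht ⟨h, hcon⟩
        -- After replacing both children by variants from level `k`, every child lies strictly below
        -- the new bound, so the node respects it.
        obtain ⟨g, hg1, hg2⟩ := ihk (f i) (by omega)
        obtain ⟨g', hg1', hg2'⟩ := ihk (f j) (by omega)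
        have hcard : 2 ^ 2 ^ (k + 1) = 2 ^ 2 ^ k * 2 ^ 2 ^ k := by
          rw [← pow_add, pow_succ 2 k]
          ring_nf
        rw [hcard]
        refine ⟨fun a => node r hr (Function.update (Function.update c i
          (g (finProdFinEquiv.symm a).1)) j (g' (finProdFinEquiv.symm a).2)),
          fun a b hab => ?_, fun a => ?_⟩
        · have h' : Function.update (Function.update c i
              (g (finProdFinEquiv.symm a).1)) j (g' (finProdFinEquiv.symm a).2) =
              Function.update (Function.update c i
              (g (finProdFinEquiv.symm b).1)) j (g' (finProdFinEquiv.symm b).2) := by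
            simpa using hab
          have hj' := congrFun h' j
          have hi' := congrFun h' i
          rw [Function.update_self, Function.update_self] at hj'
          rw [Function.update_of_ne hij, Function.update_of_ne hij, Function.update_self,
            Function.update_self] at hi'
          exact finProdFinEquiv.symm.injective (Prod.ext (hg1 hi') (hg1' hj'))
        · beta_reduce
          generalize finProdFinEquiv.symm a = p
          constructor
          · have e1 := sum_ruleMultiset_update (Function.update c i (g p.1)) j (g' p.2)
            have e2 := sum_ruleMultiset_update c i (g p.1)
            rw [Function.update_of_ne hij.symm, (hg2' p.2).1, hc j] at e1
            rw [(hg2 p.1).1, hc i] at e2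
            rw [ruleMultiset_node, add_right_cancel e1, add_right_cancel e2, ruleMultiset_node]
            simp only [hc]
          · refine le_trans ((strahler_le_iff _ (Fintype.card G.NT + (k + 1))).2 ?_) le_rfl
            have hlt : ∀ l, (Function.update (Function.update c i (g p.1)) j (g' p.2) l).dim <
                Fintype.card G.NT + (k + 1) := fun l => by
              by_cases hl : l = j
              · subst hl
                rw [Function.update_self]
                have := (hg2' p.2).2
                omega
              · rw [Function.update_of_ne hl]
                by_cases hl' : l = i
                · subst hl'
                  rw [Function.update_self]
                  have := (hg2 p.1).2
                  omega
                · rw [Function.update_of_ne hl']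
                  have := hcd l
                  omega
            exact ⟨fun l => (hlt l).le, fun x _ hx => absurd hx (hlt x).ne⟩

end DerivTree

/-! ### Generating series of weighted sets -/

/-- The generating series of a set of objects with weights in `ℕ^T`. -/
def weightSeries {T α : Type*} (w : α → T →₀ ℕ) (A : Set α) : MvPowerSeries T ℕ∞ :=
  fun v => {a | a ∈ A ∧ w a = v}.encard

section weightSeries

variable {T α β : Type*}

theorem coeff_weightSeries (w : α → T →₀ ℕ) (A : Set α) (v : T →₀ ℕ) :
    MvPowerSeries.coeff v (weightSeries w A) = {a | a ∈ A ∧ w a = v}.encard := rfl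

theorem encard_biUnion_finset {ι : Type*} (s : Finset ι) (A : ι → Set α)
    (h : (s : Set ι).PairwiseDisjoint A) : (⋃ i ∈ s, A i).encard = ∑ i ∈ s, (A i).encard := by
  rw [← finsum_mem_coe_finset, ← s.finite_toSet.encard_biUnion h]
  rfl

theorem weightSeries_biUnion {ι : Type*} (w : α → T →₀ ℕ) (s : Finset ι) (A : ι → Set α)
    (h : (s : Set ι).PairwiseDisjoint A) :
    weightSeries w (⋃ i ∈ s, A i) = ∑ i ∈ s, weightSeries w (A i) := by
  ext v
  rw [map_sum]
  simp only [coeff_weightSeries]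
  rw [← encard_biUnion_finset s (fun i => {a | a ∈ A i ∧ w a = v})]
  · congr 1
    ext a
    simp only [Set.mem_iUnion, Set.mem_ofPred_eq]
    tauto
  · intro i hi j hj hij
    exact (h hi hj hij).mono (fun a ha => ha.1) (fun a ha => ha.1)

theorem weightSeries_image (w : α → T →₀ ℕ) (g : β → α) (hg : Function.Injective g) (A : Set β) :
    weightSeries w (g '' A) = weightSeries (fun b => w (g b)) A := by
  ext v
  simp only [coeff_weightSeries]
  rw [← hg.encard_image]
  congr 1
  ext a
  simp only [Set.mem_image, Set.mem_ofPred_eq]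
  constructor
  · rintro ⟨⟨b, hb, rfl⟩, hv⟩
    exact ⟨b, ⟨hb, hv⟩, rfl⟩
  · rintro ⟨b, ⟨hb, hv⟩, rfl⟩
    exact ⟨⟨b, hb, rfl⟩, hv⟩

theorem weightSeries_add_left (w : α → T →₀ ℕ) (c : T →₀ ℕ) (A : Set α) :
    weightSeries (fun a => c + w a) A = MvPowerSeries.monomial c 1 * weightSeries w A := by
  ext v
  rw [MvPowerSeries.coeff_monomial_mul]
  simp only [coeff_weightSeries, one_mul]
  split_ifs with h
  · congr 1
    ext a
    simp only [Set.mem_ofPred_eq, and_congr_right_iff]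
    intro _
    constructor
    · intro hv
      rw [← hv, add_tsub_cancel_left]
    · intro hv
      rw [hv, add_tsub_cancel_of_le h]
  · rw [Set.encard_eq_zero, Set.eq_empty_iff_forall_notMem]
    rintro a ⟨-, rfl⟩
    exact h le_self_add

/-- Families of total weight `v` are sorted by their tuples of weights, which are the decompositions
of `v` in the Cauchy product. Counting in `ℕ∞` removes any finiteness assumption. -/
theorem weightSeries_pi {n : ℕ} {α : Fin n → Type*} (w : ∀ i, α i → T →₀ ℕ)
    (A : ∀ i, Set (α i)) :
    weightSeries (fun f : ∀ i, α i => ∑ i, w i (f i)) (Set.univ.pi A) =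
      ∏ i, weightSeries (w i) (A i) := by
  ext v
  rw [MvPowerSeries.coeff_prod]
  simp only [coeff_weightSeries]
  have h1 : ∀ l : Fin n →₀ (T →₀ ℕ), ∏ i, {a | a ∈ A i ∧ w i a = l i}.encard =
      (Set.univ.pi fun i => {a | a ∈ A i ∧ w i a = l i}).encard := fun l =>
    Set.encard_pi_eq_prod_encard.symm
  simp only [h1]
  rw [← encard_biUnion_finset]
  · congr 1
    ext f
    simp only [Set.mem_ofPred_eq, Set.mem_pi, Set.mem_univ, true_implies, Set.mem_iUnion,
      Finset.mem_finsuppAntidiag, exists_prop]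
    constructor
    · rintro ⟨h2, h3⟩
      exact ⟨Finsupp.equivFunOnFinite.symm fun i => w i (f i), ⟨h3, Finset.subset_univ _⟩,
        fun i => ⟨h2 i, rfl⟩⟩
    · rintro ⟨l, ⟨h2, -⟩, h3⟩
      refine ⟨fun i => (h3 i).1, ?_⟩
      rw [← h2]
      exact Finset.sum_congr rfl fun i _ => (h3 i).2
  · intro l _ l' _ hl
    rw [Function.onFun, Set.disjoint_left]
    intro f hf hf'
    apply hl
    ext1 i
    exact (hf i trivial).2.symm.trans (hf' i trivial).2

end weightSeries

/-! ### Collapsing series -/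

namespace CollapsedNat

theorem ofENat_coe (k n : ℕ) : ofENat k (n : ℕ∞) = ofNat k n := by
  apply Subtype.ext
  change min (min (n : ℕ∞) (k : ℕ∞)).toNat k = min n k
  rw [show min (n : ℕ∞) (k : ℕ∞) = ((min n k : ℕ) : ℕ∞) from
    (Nat.mono_cast.map_min (a := n) (b := k)).symm, ENat.toNat_natCast]
  omega

theorem ofENat_top (k : ℕ) : ofENat k ⊤ = ofNat k k := by
  apply Subtype.ext
  change min (min ⊤ (k : ℕ∞)).toNat k = min k k
  simp

theorem val_ofNat (k n : ℕ) : (ofNat k n).1 = min n k := rfl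

theorem val_add {k : ℕ} (a b : CollapsedNat k) : (a + b).1 = min (a.1 + b.1) k := rfl

theorem le_val_ofENat_iff {k c : ℕ} {x : ℕ∞} :
    c ≤ (ofENat k x).1 ↔ c ≤ k ∧ (c : ℕ∞) ≤ x := by
  cases x with
  | top => rw [ofENat_top, val_ofNat]; simp
  | coe n => rw [ofENat_coe, val_ofNat, le_min_iff, Nat.cast_le, and_comm]

theorem ofENat_add (k : ℕ) (x y : ℕ∞) : ofENat k (x + y) = ofENat k x + ofENat k y := by
  cases x with
  | top =>
    apply Subtype.ext
    rw [top_add, ofENat_top, val_add, val_ofNat]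
    omega
  | coe m =>
    cases y with
    | top =>
      apply Subtype.ext
      rw [add_top, ofENat_top, val_add, val_ofNat]
      omega
    | coe n => rw [← Nat.cast_add, ofENat_coe, ofENat_coe, ofENat_coe, ofNat_add]

theorem ofNat_self_mul (k n : ℕ) (hn : n ≠ 0) : ofNat k k * ofNat k n = ofNat k k := by
  rw [← ofNat_mul]
  apply Subtype.ext
  rw [val_ofNat, val_ofNat, min_self, min_eq_right]
  exact Nat.le_mul_of_pos_right k (Nat.pos_of_ne_zero hn)

/-- In both semirings the infinite element absorbs positive factors, while its product with zero is
zero. -/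
theorem ofENat_mul (k : ℕ) (x y : ℕ∞) : ofENat k (x * y) = ofENat k x * ofENat k y := by
  have key : ∀ y : ℕ∞, ofENat k (⊤ * y) = ofENat k ⊤ * ofENat k y := by
    intro y
    cases y with
    | top =>
      rw [ENat.top_mul ENat.top_ne_zero, ofENat_top]
      rcases Nat.eq_zero_or_pos k with rfl | hk
      · rw [← ofNat_mul]
      · rw [ofNat_self_mul k k hk.ne']
    | coe n =>
      rcases Nat.eq_zero_or_pos n with rfl | hn
      · rw [Nat.cast_zero, mul_zero, ← Nat.cast_zero, ofENat_coe, ofENat_top, ← ofNat_mul, mul_zero]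
      · rw [ENat.top_mul (by exact_mod_cast hn.ne'), ofENat_top, ofENat_coe,
          ofNat_self_mul k n hn.ne']
  cases x with
  | top => exact key y
  | coe m =>
    cases y with
    | top => rw [mul_comm, key, mul_comm]
    | coe n => rw [← Nat.cast_mul, ofENat_coe, ofENat_coe, ofENat_coe, ofNat_mul]

/-- The projection `ℕ ∪ {∞} → ℕ_k` as a homomorphism of semirings. -/
def ofENatHom (k : ℕ) : ℕ∞ →+* CollapsedNat k where
  toFun := ofENat k
  map_zero' := ofENat_coe k 0
  map_one' := ofENat_coe k 1
  map_add' := ofENat_add k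
  map_mul' := ofENat_mul k

end CollapsedNat

/-! ### Parikh vectors -/

theorem parikhVector_append {T : Type*} (u v : List T) :
    parikhVector (u ++ v) = parikhVector u + parikhVector v := by
  simp [parikhVector]

/-- The Parikh vector of the letters of a sentential form. -/
def terminalParikh {T N : Type*} : List (Symbol T N) → T →₀ ℕ
  | [] => 0
  | Symbol.terminal a :: γ => Finsupp.single a 1 + terminalParikh γ
  | Symbol.nonterminal _ :: γ => terminalParikh γ

theorem parikhVector_plugIn {T N : Type*} (γ : List (Symbol T N))
    (w : Fin (varsOf γ).length → List T) :
    parikhVector (plugIn id γ w) = terminalParikh γ + ∑ i, parikhVector (w i) := by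
  induction γ with
  | nil =>
    have h : ∑ i, parikhVector (w i) = 0 := Finset.sum_eq_zero fun i _ => Fin.elim0 i
    rw [h]
    rfl
  | cons s γ ih =>
    cases s with
    | terminal a =>
      change Fin (varsOf γ).length → List T at w
      change parikhVector ([a] ++ plugIn id γ w) = Finsupp.single a 1 + terminalParikh γ +
        ∑ i : Fin (varsOf γ).length, parikhVector (w i)
      rw [parikhVector_append, ih, add_assoc]
      simp [parikhVector]
    | nonterminal X =>
      rw [plugIn, parikhVector_append, ih, terminalParikh]
      have : ∑ i, parikhVector (w i) =
          parikhVector (w ⟨0, Nat.succ_pos _⟩) + ∑ i : Fin (varsOf γ).length,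
            parikhVector (w i.succ) :=
        Fin.sum_univ_succ (n := (varsOf γ).length) fun i => parikhVector (w i)
      rw [this]
      abel

namespace DerivTree

variable {T : Type*} {G : ContextFreeGrammar T}

/-- The Parikh vector of the yield of a derivation tree. -/
def parikh {X : G.NT} (t : DerivTree G X) : T →₀ ℕ := parikhVector t.yield

theorem parikh_node (r : ContextFreeRule T G.NT) (hr : r ∈ G.rules)
    (f : ∀ i : Fin (varsOf r.output).length, DerivTree G ((varsOf r.output).get i)) :
    (node r hr f).parikh = terminalParikh r.output + ∑ i, (f i).parikh :=
  parikhVector_plugIn _ _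

/-- This is where commutativity enters: rearranging a tree without changing its rules keeps its
Parikh vector. -/
theorem parikh_eq_sum {X : G.NT} (t : DerivTree G X) :
    t.parikh = (t.ruleMultiset.map fun r => terminalParikh r.output).sum := by
  induction t with
  | node r hr f ih =>
    rw [parikh_node, ruleMultiset_node, Multiset.map_add, Multiset.sum_add,
      Multiset.map_singleton, Multiset.sum_singleton]
    congr 1
    have h : ∀ s : Finset (Fin (varsOf r.output).length),
        ((∑ i ∈ s, (f i).ruleMultiset).map fun r => terminalParikh r.output).sum =
          ∑ i ∈ s, (f i).parikh := fun s => by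
      induction s using Finset.induction_on with
      | empty => simp
      | insert a s ha ihs =>
        rw [Finset.sum_insert ha, Finset.sum_insert ha, Multiset.map_add, Multiset.sum_add, ihs,
          ih]
    rw [h]

/-- The rule at the root of a derivation tree. -/
def rootRule : {X : G.NT} → DerivTree G X → ContextFreeRule T G.NT
  | _, .node r _ _ => r

theorem rootRule_mem {X : G.NT} (t : DerivTree G X) : t.rootRule ∈ G.rules := by
  cases t; assumption

theorem rootRule_input {X : G.NT} (t : DerivTree G X) : t.rootRule.input = X := by
  cases t; rfl

theorem exists_eq_cast_node {X : G.NT} (t : DerivTree G X) :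
    ∀ (r : ContextFreeRule T G.NT) (hr : r ∈ G.rules) (h : r.input = X), t.rootRule = r →
      ∃ f, t = h ▸ node r hr f := by
  cases t with
  | node r hr f =>
    intro r' hr' h e
    cases e
    exact ⟨f, rfl⟩

theorem node_injective (r : ContextFreeRule T G.NT) (hr : r ∈ G.rules) :
    Function.Injective (node r hr) := fun f g h => by simpa using h

/-- The height of a derivation tree. -/
def height : {X : G.NT} → DerivTree G X → ℕ
  | _, .node _ _ t => (Finset.univ.sup fun i => (t i).height) + 1

end DerivTree

/-! ### Root decomposition -/

section treeSeries

variable {T : Type*} {G : ContextFreeGrammar T}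

/-- The series in `ℕ_k⟨⟨ℕ^T⟩⟩` that counts the trees in `A` by the Parikh vectors of their
yields. -/
def treeSeries (k : ℕ) {X : G.NT} (A : Set (DerivTree G X)) : MvPowerSeries T (CollapsedNat k) :=
  MvPowerSeries.map (CollapsedNat.ofENatHom k) (weightSeries DerivTree.parikh A)

theorem treeSeries_apply (k : ℕ) {X : G.NT} (A : Set (DerivTree G X)) (v : T →₀ ℕ) :
    treeSeries k A v = CollapsedNat.ofENat k {t | t ∈ A ∧ t.parikh = v}.encard := rfl

theorem cambMod_eq_treeSeries (k : ℕ) (X : G.NT) :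
    cambMod k G X = treeSeries k (Set.univ : Set (DerivTree G X)) := by
  funext v
  rw [treeSeries_apply]
  simp only [Set.mem_univ, true_and]
  rfl

theorem treeSeries_biUnion {ι : Type*} (k : ℕ) {X : G.NT} (s : Finset ι)
    (A : ι → Set (DerivTree G X)) (h : (s : Set ι).PairwiseDisjoint A) :
    treeSeries k (⋃ i ∈ s, A i) = ∑ i ∈ s, treeSeries k (A i) := by
  rw [treeSeries, weightSeries_biUnion _ _ _ h, map_sum]
  rfl

/-- The contribution of the rules for `X` to the right-hand sides of the polynomial system of a
grammar whose variables are refined by attributes in `Q`, where `Δ r` are the admissible attributes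
of the children at a node with the rule `r`. -/
def ruleSum {Q R : Type*} [CommSemiring R] (G : ContextFreeGrammar T) (X : G.NT)
    (Δ : ∀ r : ContextFreeRule T G.NT, Finset (Fin (varsOf r.output).length → Q))
    (y : G.NT → Q → MvPowerSeries T R) : MvPowerSeries T R :=
  ∑ r ∈ G.rules.filter (fun r => r.input = X),
    MvPowerSeries.monomial (terminalParikh r.output) 1 *
      ∑ δ ∈ Δ r, ∏ i, y ((varsOf r.output).get i) (δ i)

/-- Trees are split by root rule and then by the attributes of the children; `hB` makes the pieces
disjoint. The attributes serve for dimensions and, with `Unit`, for plain counting. `A` and `B` are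
separate so that a height bound can drop by one from root to children. -/
theorem treeSeries_eq_ruleSum {Q : Type*} (k : ℕ)
    (Δ : ∀ r : ContextFreeRule T G.NT, Finset (Fin (varsOf r.output).length → Q))
    (A : ∀ X, Set (DerivTree G X)) (B : ∀ X, Q → Set (DerivTree G X))
    (hA : ∀ r hr f, DerivTree.node r hr f ∈ A r.input ↔ ∃ δ ∈ Δ r, ∀ i, f i ∈ B _ (δ i))
    (hB : ∀ X q q', q ≠ q' → Disjoint (B X q) (B X q')) (X : G.NT) :
    treeSeries k (A X) = ruleSum G X Δ fun Y q => treeSeries k (B Y q) := by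
  have h1 : A X = ⋃ r ∈ G.rules.filter (fun r => r.input = X), {t | t ∈ A X ∧ t.rootRule = r} := by
    ext t
    simp only [Set.mem_iUnion, Set.mem_ofPred_eq, Finset.mem_filter, exists_prop]
    constructor
    · exact fun ht => ⟨t.rootRule, ⟨t.rootRule_mem, t.rootRule_input⟩, ht, rfl⟩
    · rintro ⟨r, -, ht, -⟩
      exact ht
  rw [h1, treeSeries_biUnion, ruleSum]
  · refine Finset.sum_congr rfl fun r hmem => ?_
    obtain ⟨hr, rfl⟩ := Finset.mem_filter.1 hmem
    have h2 : {t | t ∈ A r.input ∧ t.rootRule = r} =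
        ⋃ δ ∈ Δ r, DerivTree.node r hr '' (Set.univ.pi fun i => B _ (δ i)) := by
      ext t
      simp only [Set.mem_iUnion, Set.mem_ofPred_eq, exists_prop, Set.mem_image, Set.mem_pi,
        Set.mem_univ, true_implies]
      constructor
      · rintro ⟨ht, hroot⟩
        obtain ⟨f, rfl⟩ := t.exists_eq_cast_node r hr rfl hroot
        obtain ⟨δ, hδ, hf⟩ := (hA r hr f).1 ht
        exact ⟨δ, hδ, f, hf, rfl⟩
      · rintro ⟨δ, hδ, f, hf, rfl⟩
        exact ⟨(hA r hr f).2 ⟨δ, hδ, hf⟩, rfl⟩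
    rw [h2, treeSeries_biUnion, Finset.mul_sum]
    · refine Finset.sum_congr rfl fun δ _ => ?_
      rw [treeSeries, weightSeries_image _ _ (DerivTree.node_injective r hr)]
      simp only [DerivTree.parikh_node]
      rw [weightSeries_add_left, weightSeries_pi (fun _ => DerivTree.parikh), map_mul, map_prod,
        MvPowerSeries.map_monomial, map_one]
      rfl
    · intro δ _ δ' _ hδ
      rw [Function.onFun, Set.disjoint_image_iff (DerivTree.node_injective r hr),
        Set.disjoint_left]
      intro f hf hf'
      obtain ⟨i, hi⟩ := Function.ne_iff.1 hδ
      exact Set.disjoint_left.1 (hB _ _ _ hi) (hf i trivial) (hf' i trivial)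
  · intro r _ r' _ hrr
    rw [Function.onFun, Set.disjoint_left]
    rintro t ⟨-, rfl⟩ ⟨-, rfl⟩
    exact hrr rfl

end treeSeries

/-! ### The natural order -/

namespace NaturalLE

variable {S : Type*} [CommSemiring S] {a b c d : S}

theorem refl (a : S) : NaturalLE a a := ⟨0, add_zero a⟩

theorem trans (h : NaturalLE a b) (h' : NaturalLE b c) : NaturalLE a c := by
  obtain ⟨x, rfl⟩ := h
  obtain ⟨y, rfl⟩ := h'
  exact ⟨x + y, (add_assoc _ _ _).symm⟩

theorem add (h : NaturalLE a b) (h' : NaturalLE c d) : NaturalLE (a + c) (b + d) := by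
  obtain ⟨x, rfl⟩ := h
  obtain ⟨y, rfl⟩ := h'
  exact ⟨x + y, add_add_add_comm _ _ _ _⟩

theorem mul (h : NaturalLE a b) (h' : NaturalLE c d) : NaturalLE (a * c) (b * d) := by
  obtain ⟨x, rfl⟩ := h
  obtain ⟨y, rfl⟩ := h'
  exact ⟨a * y + x * c + x * y, by ring⟩

theorem sum {ι : Type*} (s : Finset ι) {f g : ι → S} (h : ∀ i ∈ s, NaturalLE (f i) (g i)) :
    NaturalLE (∑ i ∈ s, f i) (∑ i ∈ s, g i) := by
  induction s using Finset.induction_on with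
  | empty => exact refl _
  | insert a s ha ih =>
    rw [Finset.sum_insert ha, Finset.sum_insert ha]
    exact (h a (Finset.mem_insert_self a s)).add
      (ih fun i hi => h i (Finset.mem_insert_of_mem hi))

theorem prod {ι : Type*} (s : Finset ι) {f g : ι → S} (h : ∀ i ∈ s, NaturalLE (f i) (g i)) :
    NaturalLE (∏ i ∈ s, f i) (∏ i ∈ s, g i) := by
  induction s using Finset.induction_on with
  | empty => exact refl _
  | insert a s ha ih =>
    rw [Finset.prod_insert ha, Finset.prod_insert ha]
    exact (h a (Finset.mem_insert_self a s)).mul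
      (ih fun i hi => h i (Finset.mem_insert_of_mem hi))

theorem zero_le (a : S) : NaturalLE 0 a := ⟨a, zero_add a⟩

end NaturalLE

section CollapsedSeries

variable {T : Type*} {k : ℕ}

theorem naturalLE_iff_val_le {a b : MvPowerSeries T (CollapsedNat k)} :
    NaturalLE a b ↔ ∀ v, (a v).1 ≤ (b v).1 := by
  constructor
  · rintro ⟨d, rfl⟩ v
    have h : ((a + d) v).1 = min ((a v).1 + (d v).1) k := rfl
    rw [h]
    have := (a v).2
    omega
  · intro h
    refine ⟨fun v => CollapsedNat.ofNat k ((b v).1 - (a v).1), ?_⟩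
    funext v
    apply Subtype.ext
    change min ((a v).1 + min ((b v).1 - (a v).1) k) k = (b v).1
    have := h v
    have := (b v).2
    omega

theorem NaturalLE.antisymm {a b : MvPowerSeries T (CollapsedNat k)} (h : NaturalLE a b)
    (h' : NaturalLE b a) : a = b := by
  funext v
  exact Subtype.ext (le_antisymm (naturalLE_iff_val_le.1 h v) (naturalLE_iff_val_le.1 h' v))

/-! ### Kleene stars and linear systems -/

/-- Each coefficient of the partial sums increases and is bounded by `k`, hence is eventually
constant. -/
theorem exists_star (a : MvPowerSeries T (CollapsedNat k)) :
    ∃ s, IsKleeneStar a s ∧ ∀ v, ∃ N, ∀ n, N ≤ n → (∑ i ∈ Finset.range n, a ^ i) v = s v := by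
  have hmono : ∀ m n, m ≤ n →
      NaturalLE (∑ i ∈ Finset.range m, a ^ i) (∑ i ∈ Finset.range n, a ^ i) := fun m n hmn =>
    ⟨∑ i ∈ Finset.Ico m n, a ^ i, Finset.sum_range_add_sum_Ico _ hmn⟩
  have hstab : ∀ v, ∃ N, ∀ n, N ≤ n → (∑ i ∈ Finset.range n, a ^ i) v =
      (∑ i ∈ Finset.range N, a ^ i) v := by
    intro v
    have hbdd : BddAbove (Set.range fun n => ((∑ i ∈ Finset.range n, a ^ i) v).1) := by
      refine ⟨k, ?_⟩
      rintro _ ⟨n, rfl⟩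
      exact ((∑ i ∈ Finset.range n, a ^ i) v).2
    obtain ⟨N, hN⟩ := Nat.sSup_mem (Set.range_nonempty _) hbdd
    refine ⟨N, fun n hn => Subtype.ext (le_antisymm ?_ ?_)⟩
    · exact (le_csSup hbdd ⟨n, rfl⟩).trans hN.ge
    · exact naturalLE_iff_val_le.1 (hmono N n hn) v
  choose N hN using hstab
  refine ⟨fun v => (∑ i ∈ Finset.range (N v), a ^ i) v, ⟨fun n => ?_, fun u hu => ?_⟩,
    fun v => ⟨N v, hN v⟩⟩
  · refine naturalLE_iff_val_le.2 fun v => ?_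
    rcases le_total n (N v) with h | h
    · exact naturalLE_iff_val_le.1 (hmono _ _ h) v
    · rw [hN v n h]
  · exact naturalLE_iff_val_le.2 fun v => naturalLE_iff_val_le.1 (hu (N v)) v

/-- `s` satisfies the laws of the star of `a`: `s * b` is the least solution of
`a * x + b ≤ x`. -/
theorem exists_star_least (a : MvPowerSeries T (CollapsedNat k)) :
    ∃ s, IsKleeneStar a s ∧ (∀ b, NaturalLE (a * (s * b) + b) (s * b)) ∧
      ∀ b x, NaturalLE (a * x + b) x → NaturalLE (s * b) x := by
  obtain ⟨s, hs, hlim⟩ := exists_star a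
  -- A coefficient of a Cauchy product involves finitely many coefficients of `s`, so a single
  -- partial sum already gives it.
  have hcoeff : ∀ c v, ∃ n, (c * ∑ i ∈ Finset.range n, a ^ i) v = (c * s) v := by
    intro c v
    choose N hN using hlim
    refine ⟨(Finset.HasAntidiagonal.antidiagonal v).sup fun p => N p.2, ?_⟩
    have hmul : ∀ d, (c * d) v = ∑ p ∈ Finset.HasAntidiagonal.antidiagonal v,
        MvPowerSeries.coeff p.1 c * MvPowerSeries.coeff p.2 d := fun d => by
      rw [← MvPowerSeries.coeff_mul]
      rfl
    rw [hmul, hmul]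
    refine Finset.sum_congr rfl fun p hp => ?_
    congr 1
    exact hN p.2 _ (Finset.le_sup (f := fun p => N p.2) hp)
  have hsucc : ∀ n, ∑ i ∈ Finset.range (n + 1), a ^ i =
      a * ∑ i ∈ Finset.range n, a ^ i + 1 := fun n => by
    rw [Finset.sum_range_succ', Finset.mul_sum, pow_zero]
    simp only [pow_succ']
  refine ⟨s, hs, fun b => ?_, fun b x hx => ?_⟩
  · have h1 : NaturalLE (a * s + 1) s := by
      rw [naturalLE_iff_val_le]
      intro v
      obtain ⟨n, hn⟩ := hcoeff a v
      have h2 : (a * s + 1) v = (∑ i ∈ Finset.range (n + 1), a ^ i) v := by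
        rw [hsucc]
        change (a * s) v + _ = (a * _) v + _
        rw [hn]
      rw [h2]
      exact naturalLE_iff_val_le.1 (hs.1 (n + 1)) v
    have := h1.mul (NaturalLE.refl b)
    rwa [add_mul, one_mul, mul_assoc] at this
  · have h1 : ∀ n, NaturalLE (b * ∑ i ∈ Finset.range n, a ^ i) x := by
      intro n
      induction n with
      | zero => rw [Finset.range_zero, Finset.sum_empty, mul_zero]; exact NaturalLE.zero_le x
      | succ n ih =>
        rw [hsucc, mul_add, mul_one, mul_left_comm]
        exact (((NaturalLE.refl a).mul ih).add (NaturalLE.refl b)).trans hx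
    rw [mul_comm, naturalLE_iff_val_le]
    intro v
    obtain ⟨n, hn⟩ := hcoeff b v
    rw [← hn]
    exact naturalLE_iff_val_le.1 (h1 n) v

namespace IsRationalSeries

theorem zero {R : Type*} [CommSemiring R] : IsRationalSeries (0 : MvPowerSeries T R) := by
  simpa using IsRationalSeries.const (σ := T) (0 : R)

theorem one {R : Type*} [CommSemiring R] : IsRationalSeries (1 : MvPowerSeries T R) := by
  simpa using IsRationalSeries.const (σ := T) (1 : R)

theorem sum {R ι : Type*} [CommSemiring R] (s : Finset ι) {f : ι → MvPowerSeries T R}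
    (h : ∀ i ∈ s, IsRationalSeries (f i)) : IsRationalSeries (∑ i ∈ s, f i) := by
  induction s using Finset.induction_on with
  | empty => exact zero
  | insert a s ha ih =>
    rw [Finset.sum_insert ha]
    exact (h a (Finset.mem_insert_self a s)).add
      (ih fun i hi => h i (Finset.mem_insert_of_mem hi))

theorem prod {R ι : Type*} [CommSemiring R] (s : Finset ι) {f : ι → MvPowerSeries T R}
    (h : ∀ i ∈ s, IsRationalSeries (f i)) : IsRationalSeries (∏ i ∈ s, f i) := by
  induction s using Finset.induction_on with
  | empty => exact one
  | insert a s ha ih =>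
    rw [Finset.prod_insert ha]
    exact (h a (Finset.mem_insert_self a s)).mul
      (ih fun i hi => h i (Finset.mem_insert_of_mem hi))

end IsRationalSeries

/-- The least solution of a finite linear system with rational coefficients is rational. -/
theorem exists_rational_least_solution_fin (n : ℕ)
    (A : Fin n → Fin n → MvPowerSeries T (CollapsedNat k))
    (b : Fin n → MvPowerSeries T (CollapsedNat k))
    (hA : ∀ i j, IsRationalSeries (A i j)) (hb : ∀ i, IsRationalSeries (b i)) :
    ∃ x : Fin n → MvPowerSeries T (CollapsedNat k), (∀ i, IsRationalSeries (x i)) ∧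
      (∀ i, NaturalLE (∑ j, A i j * x j + b i) (x i)) ∧
      ∀ y : Fin n → MvPowerSeries T (CollapsedNat k),
        (∀ i, NaturalLE (∑ j, A i j * y j + b i) (y i)) → ∀ i, NaturalLE (x i) (y i) := by
  induction n with
  | zero => exact ⟨fun i => i.elim0, fun i => i.elim0, fun i => i.elim0, fun _ _ i => i.elim0⟩
  | succ n ih =>
    obtain ⟨s, hs, hs1, hs2⟩ := exists_star_least (A 0 0)
    have hsr : IsRationalSeries s := (hA 0 0).star hs
    -- Gaussian elimination: unknown `0` is replaced by `s * (∑ j, A 0 j.succ * x j + b 0)`, which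
    -- leaves a system in the remaining unknowns.
    obtain ⟨x, hx, hx1, hx2⟩ := ih
      (fun i j => A i.succ 0 * (s * A 0 j.succ) + A i.succ j.succ)
      (fun i => A i.succ 0 * (s * b 0) + b i.succ)
      (fun i j => ((hA _ _).mul (hsr.mul (hA _ _))).add (hA _ _))
      (fun i => ((hA _ _).mul (hsr.mul (hb _))).add (hb _))
    have key : ∀ (i : Fin n) (z : Fin n → MvPowerSeries T (CollapsedNat k)),
        ∑ j, (A i.succ 0 * (s * A 0 j.succ) + A i.succ j.succ) * z j +
            (A i.succ 0 * (s * b 0) + b i.succ) =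
          A i.succ 0 * (s * (∑ j : Fin n, A 0 j.succ * z j + b 0)) +
            ∑ j : Fin n, A i.succ j.succ * z j + b i.succ := by
      intro i z
      simp only [add_mul, Finset.sum_add_distrib, mul_add, Finset.mul_sum, mul_assoc]
      abel
    refine ⟨Fin.cons (s * (∑ j : Fin n, A 0 j.succ * x j + b 0)) x, ?_, ?_, ?_⟩
    · refine Fin.cases ?_ fun i => ?_
      · exact hsr.mul ((IsRationalSeries.sum _ fun j _ => (hA _ _).mul (hx j)).add (hb 0))
      · exact hx i
    · refine Fin.cases ?_ fun i => ?_
      · rw [Fin.sum_univ_succ]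
        simp only [Fin.cons_zero, Fin.cons_succ]
        rw [add_assoc]
        exact hs1 _
      · rw [Fin.sum_univ_succ]
        simp only [Fin.cons_zero, Fin.cons_succ]
        have := hx1 i
        rwa [key] at this
    · intro y hy
      have h0 : NaturalLE (s * (∑ j : Fin n, A 0 j.succ * y j.succ + b 0)) (y 0) := by
        apply hs2
        have := hy 0
        rwa [Fin.sum_univ_succ, add_assoc] at this
      have h1 : ∀ i, NaturalLE (x i) (y i.succ) := by
        refine hx2 (fun i => y i.succ) fun i => ?_
        rw [key]
        refine NaturalLE.trans ?_ (hy i.succ)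
        rw [Fin.sum_univ_succ]
        exact (((NaturalLE.refl _).mul h0).add (NaturalLE.refl _)).add (NaturalLE.refl _)
      refine Fin.cases ?_ fun i => ?_
      · refine NaturalLE.trans ?_ h0
        exact (NaturalLE.refl _).mul
          ((NaturalLE.sum _ fun j _ => (NaturalLE.refl _).mul (h1 j)).add (NaturalLE.refl _))
      · exact h1 i

theorem exists_rational_least_solution {ι : Type*} [Fintype ι]
    (A : ι → ι → MvPowerSeries T (CollapsedNat k)) (b : ι → MvPowerSeries T (CollapsedNat k))
    (hA : ∀ i j, IsRationalSeries (A i j)) (hb : ∀ i, IsRationalSeries (b i)) :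
    ∃ x : ι → MvPowerSeries T (CollapsedNat k), (∀ i, IsRationalSeries (x i)) ∧
      (∀ i, NaturalLE (∑ j, A i j * x j + b i) (x i)) ∧
      ∀ y : ι → MvPowerSeries T (CollapsedNat k),
        (∀ i, NaturalLE (∑ j, A i j * y j + b i) (y i)) → ∀ i, NaturalLE (x i) (y i) := by
  let e := Fintype.equivFin ι
  obtain ⟨x, h1, h2, h3⟩ := exists_rational_least_solution_fin (Fintype.card ι)
    (fun i j => A (e.symm i) (e.symm j)) (fun i => b (e.symm i)) (fun _ _ => hA _ _)
    (fun _ => hb _)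
  refine ⟨fun i => x (e i), fun i => h1 _, fun i => ?_, fun y hy i => ?_⟩
  · have := h2 (e i)
    rw [← e.sum_comp] at this
    simpa only [Equiv.symm_apply_apply] using this
  · have := h3 (fun i => y (e.symm i)) (fun i => ?_) (e i)
    · simpa only [Equiv.symm_apply_apply] using this
    · rw [e.symm.sum_comp fun j => A (e.symm i) j * y j]
      exact hy _

end CollapsedSeries

/-! ### Leastness of the counting series -/

section leastness

variable {T : Type*} {G : ContextFreeGrammar T}

theorem ruleSum_mono {Q : Type*} {k : ℕ} (X : G.NT)
    (Δ : ∀ r : ContextFreeRule T G.NT, Finset (Fin (varsOf r.output).length → Q))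
    {y z : G.NT → Q → MvPowerSeries T (CollapsedNat k)} (h : ∀ X q, NaturalLE (y X q) (z X q)) :
    NaturalLE (ruleSum G X Δ y) (ruleSum G X Δ z) :=
  NaturalLE.sum _ fun _ _ => (NaturalLE.refl _).mul
    (NaturalLE.sum _ fun _ _ => NaturalLE.prod _ fun _ _ => h _ _)

theorem ruleSum_congr {Q R : Type*} [CommSemiring R] {X : G.NT}
    {Δ : ∀ r : ContextFreeRule T G.NT, Finset (Fin (varsOf r.output).length → Q)}
    {y z : G.NT → Q → MvPowerSeries T R}
    (h : ∀ r, ∀ δ ∈ Δ r, ∀ i, y ((varsOf r.output).get i) (δ i) =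
      z ((varsOf r.output).get i) (δ i)) : ruleSum G X Δ y = ruleSum G X Δ z :=
  Finset.sum_congr rfl fun r _ => congrArg _ (Finset.sum_congr rfl fun δ hδ =>
    Finset.prod_congr rfl fun i _ => h r δ hδ i)

/-- Induction on `h` bounds the trees of height at most `h` by `y`. The passage to all trees works
because coefficients are capped at `k`. -/
theorem treeSeries_naturalLE {Q : Type*} (k : ℕ)
    (Δ : Q → ∀ r : ContextFreeRule T G.NT, Finset (Fin (varsOf r.output).length → Q))
    (F : ∀ X, Q → Set (DerivTree G X))
    (hF : ∀ q r hr f, DerivTree.node r hr f ∈ F r.input q ↔ ∃ δ ∈ Δ q r, ∀ i, f i ∈ F _ (δ i))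
    (hdisj : ∀ X q q', q ≠ q' → Disjoint (F X q) (F X q'))
    (y : G.NT → Q → MvPowerSeries T (CollapsedNat k))
    (hy : ∀ X q, NaturalLE (ruleSum G X (Δ q) y) (y X q)) (X : G.NT) (q : Q) :
    NaturalLE (treeSeries k (F X q)) (y X q) := by
  have hh : ∀ h X q, NaturalLE (treeSeries k {t | t ∈ F X q ∧ t.height ≤ h}) (y X q) := by
    intro h
    induction h with
    | zero =>
      intro X q
      have h0 : {t | t ∈ F X q ∧ t.height ≤ 0} = ⋃ i ∈ (∅ : Finset ℕ), ∅ := by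
        ext t
        cases t
        simp [DerivTree.height]
      rw [h0, treeSeries_biUnion _ _ _ (by simp), Finset.sum_empty]
      exact NaturalLE.zero_le _
    | succ h ih =>
      intro X q
      rw [treeSeries_eq_ruleSum k (Δ q) (fun X => {t | t ∈ F X q ∧ t.height ≤ h + 1})
        (fun X q => {t | t ∈ F X q ∧ t.height ≤ h})]
      · exact (ruleSum_mono X (Δ q) ih).trans (hy X q)
      · intro r hr f
        simp only [Set.mem_ofPred_eq, hF, DerivTree.height, add_le_add_iff_right, Finset.sup_le_iff,
          Finset.mem_univ, true_implies]
        constructor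
        · rintro ⟨⟨δ, h1, h2⟩, h3⟩
          exact ⟨δ, h1, fun i => ⟨h2 i, h3 i⟩⟩
        · rintro ⟨δ, h1, h2⟩
          exact ⟨⟨δ, h1, fun i => (h2 i).1⟩, fun i => (h2 i).2⟩
      · exact fun X q q' hq => (hdisj X q q' hq).mono (fun t ht => ht.1) fun t ht => ht.1
  rw [naturalLE_iff_val_le]
  intro v
  rw [treeSeries_apply]
  -- The collapsed coefficient is a finite number, witnessed by a finite set `U` of trees, whose
  -- heights are bounded.
  obtain ⟨h1, h2⟩ := CollapsedNat.le_val_ofENat_iff.1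
    (le_refl (CollapsedNat.ofENat k {t | t ∈ F X q ∧ t.parikh = v}.encard).1)
  obtain ⟨U, hU, hUc⟩ := Set.exists_subset_encard_eq h2
  have hfin : U.Finite := Set.finite_of_encard_eq_coe hUc
  obtain ⟨h, hh'⟩ := (hfin.image DerivTree.height).bddAbove
  refine le_trans ?_ (naturalLE_iff_val_le.1 (hh h X q) v)
  rw [treeSeries_apply, CollapsedNat.le_val_ofENat_iff]
  refine ⟨h1, hUc.symm.le.trans (Set.encard_le_encard fun t ht => ?_)⟩
  exact ⟨⟨(hU ht).1, hh' ⟨t, ht, rfl⟩⟩, (hU ht).2⟩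

end leastness

/-! ### Trees of a fixed dimension -/

/-- The finitely many families of Strahler numbers of the children that give the Strahler
number `e`. -/
def strahlerFiber (n e : ℕ) : Finset (Fin n → ℕ) :=
  (Fintype.piFinset fun _ => Finset.range (e + 1)).filter fun δ => strahler δ = e

theorem mem_strahlerFiber {n e : ℕ} {δ : Fin n → ℕ} : δ ∈ strahlerFiber n e ↔ strahler δ = e := by
  simp only [strahlerFiber, Finset.mem_filter, Fintype.mem_piFinset, Finset.mem_range,
    and_iff_right_iff_imp]
  rintro rfl i
  exact Nat.lt_succ_of_le (le_strahler δ i)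

theorem lt_of_strahler {n e : ℕ} {δ : Fin n → ℕ} (h : strahler δ = e) {i j : Fin n}
    (hj : δ j = e) (hij : i ≠ j) : δ i < e := by
  obtain ⟨h1, h2⟩ := (strahler_le_iff δ e).1 h.le
  exact (h1 i).lt_of_ne fun hi => hij (h2 i j hi hj)

section dimSeries

variable {T : Type*} {G : ContextFreeGrammar T}

/-- The series that counts the trees of dimension `e`. -/
def dimSeries (k : ℕ) (G : ContextFreeGrammar T) (X : G.NT) (e : ℕ) :
    MvPowerSeries T (CollapsedNat k) :=
  treeSeries k {t : DerivTree G X | t.dim = e}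

theorem node_mem_dim_iff (e : ℕ) (r : ContextFreeRule T G.NT) (hr : r ∈ G.rules)
    (f : ∀ i : Fin (varsOf r.output).length, DerivTree G ((varsOf r.output).get i)) :
    DerivTree.node r hr f ∈ {t : DerivTree G r.input | t.dim = e} ↔
      ∃ δ ∈ strahlerFiber (varsOf r.output).length e,
        ∀ i, f i ∈ {t : DerivTree G ((varsOf r.output).get i) | t.dim = δ i} := by
  simp only [Set.mem_ofPred_eq, DerivTree.dim_node, mem_strahlerFiber]
  constructor
  · intro h
    exact ⟨_, h, fun i => rfl⟩
  · rintro ⟨δ, h, hδ⟩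
    simpa only [hδ] using h

theorem disjoint_dim (X : G.NT) (e e' : ℕ) (h : e ≠ e') :
    Disjoint {t : DerivTree G X | t.dim = e} {t | t.dim = e'} := by
  rw [Set.disjoint_left]
  exact fun t ht ht' => h (ht.symm.trans ht')

theorem dimSeries_eq_ruleSum (k : ℕ) (X : G.NT) (e : ℕ) :
    dimSeries k G X e =
      ruleSum G X (fun r => strahlerFiber (varsOf r.output).length e) (dimSeries k G) :=
  treeSeries_eq_ruleSum k _ (fun X => {t : DerivTree G X | t.dim = e}) _ (node_mem_dim_iff e)
    disjoint_dim X

theorem dimSeries_naturalLE (k : ℕ) (y : G.NT → ℕ → MvPowerSeries T (CollapsedNat k))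
    (hy : ∀ X e, NaturalLE
      (ruleSum G X (fun r => strahlerFiber (varsOf r.output).length e) y) (y X e))
    (X : G.NT) (e : ℕ) : NaturalLE (dimSeries k G X e) (y X e) :=
  treeSeries_naturalLE k (fun e r => strahlerFiber (varsOf r.output).length e)
    (fun X e => {t : DerivTree G X | t.dim = e}) node_mem_dim_iff disjoint_dim y hy X e

theorem treeSeries_dim_le (k : ℕ) (X : G.NT) (d : ℕ) :
    treeSeries k {t : DerivTree G X | t.dim ≤ d} =
      ∑ e ∈ Finset.range (d + 1), dimSeries k G X e := by
  have h : {t : DerivTree G X | t.dim ≤ d} =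
      ⋃ e ∈ Finset.range (d + 1), {t : DerivTree G X | t.dim = e} := by
    ext t
    simp
  rw [h, treeSeries_biUnion]
  · rfl
  · exact fun e _ e' _ hee => disjoint_dim X e e' hee

/-! ### Rationality -/

/-- The coefficients of the linear system for the trees of dimension `e`. -/
def linearCoeff {k : ℕ} (G : ContextFreeGrammar T) (y : G.NT → ℕ → MvPowerSeries T (CollapsedNat k))
    (e : ℕ) (X Y : G.NT) : MvPowerSeries T (CollapsedNat k) :=
  ∑ r ∈ G.rules.filter (fun r => r.input = X),
    MvPowerSeries.monomial (terminalParikh r.output) 1 *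
      ∑ δ ∈ strahlerFiber (varsOf r.output).length e, ∑ j,
        if δ j = e ∧ (varsOf r.output).get j = Y then
          ∏ i ∈ Finset.univ.erase j, y ((varsOf r.output).get i) (δ i) else 0

/-- The constant terms of the linear system for the trees of dimension `e`. -/
def linearConst {k : ℕ} (G : ContextFreeGrammar T) (y : G.NT → ℕ → MvPowerSeries T (CollapsedNat k))
    (e : ℕ) (X : G.NT) : MvPowerSeries T (CollapsedNat k) :=
  ∑ r ∈ G.rules.filter (fun r => r.input = X),
    MvPowerSeries.monomial (terminalParikh r.output) 1 *
      ∑ δ ∈ strahlerFiber (varsOf r.output).length e,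
        if ∀ j, δ j < e then ∏ i, y ((varsOf r.output).get i) (δ i) else 0

/-- At most one index has `δ j = e`, so the product is linear or constant in the unknowns `y Y e`.
-/
theorem prod_eq_linear {S N : Type*} [CommSemiring S] [Fintype N] {n e : ℕ} (V : Fin n → N)
    {δ : Fin n → ℕ} (hδ : strahler δ = e) (y : N → ℕ → S) :
    ∏ i, y (V i) (δ i) =
      ∑ Y, (∑ j, if δ j = e ∧ V j = Y then ∏ i ∈ Finset.univ.erase j, y (V i) (δ i) else 0) *
        y Y e + if ∀ j, δ j < e then ∏ i, y (V i) (δ i) else 0 := by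
  by_cases h : ∃ j, δ j = e
  · obtain ⟨j, hj⟩ := h
    have hj' : ∀ l, l ≠ j → δ l ≠ e := fun l hl => (lt_of_strahler hδ hj hl).ne
    rw [if_neg (fun hcon => (hcon j).ne hj), add_zero,
      Finset.sum_eq_single_of_mem (V j) (Finset.mem_univ _),
      Finset.sum_eq_single_of_mem j (Finset.mem_univ _), if_pos ⟨hj, rfl⟩,
      ← Finset.mul_prod_erase _ _ (Finset.mem_univ j), hj, mul_comm]
    · intro l _ hl
      rw [if_neg fun hcon => hj' l hl hcon.1]
    · intro Y _ hY
      rw [Finset.sum_eq_zero, zero_mul]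
      intro l _
      rw [if_neg]
      rintro ⟨h1, h2⟩
      by_cases hl : l = j
      · exact hY (by rw [← h2, hl])
      · exact hj' l hl h1
  · push Not at h
    have hlt : ∀ j, δ j < e := fun j => (hδ ▸ le_strahler δ j).lt_of_ne (h j)
    rw [if_pos hlt, Finset.sum_eq_zero, zero_add]
    intro Y _
    rw [Finset.sum_eq_zero, zero_mul]
    intro l _
    rw [if_neg fun hcon => h l hcon.1]

theorem ruleSum_eq_linear {k : ℕ} [Fintype G.NT]
    (y : G.NT → ℕ → MvPowerSeries T (CollapsedNat k)) (e : ℕ) (X : G.NT) :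
    ruleSum G X (fun r => strahlerFiber (varsOf r.output).length e) y =
      ∑ Y, linearCoeff G y e X Y * y Y e + linearConst G y e X := by
  simp only [ruleSum, linearCoeff, linearConst, Finset.sum_mul]
  rw [Finset.sum_comm, ← Finset.sum_add_distrib]
  refine Finset.sum_congr rfl fun r _ => ?_
  simp only [mul_assoc, ← Finset.mul_sum]
  rw [← mul_add]
  congr 1
  simp only [Finset.sum_mul]
  rw [Finset.sum_comm, ← Finset.sum_add_distrib]
  refine Finset.sum_congr rfl fun δ hδ => ?_
  refine (prod_eq_linear (varsOf r.output).get (mem_strahlerFiber.1 hδ) y).trans ?_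
  simp only [Finset.sum_mul]

theorem linearCoeff_congr {k : ℕ} {y z : G.NT → ℕ → MvPowerSeries T (CollapsedNat k)} {e : ℕ}
    (h : ∀ X m, m < e → y X m = z X m) (X Y : G.NT) :
    linearCoeff G y e X Y = linearCoeff G z e X Y := by
  refine Finset.sum_congr rfl fun r _ => congrArg _ (Finset.sum_congr rfl fun δ hδ =>
    Finset.sum_congr rfl fun j _ => ?_)
  split_ifs with hj
  · exact Finset.prod_congr rfl fun i hi =>
      h _ _ (lt_of_strahler (mem_strahlerFiber.1 hδ) hj.1 (Finset.ne_of_mem_erase hi))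
  · rfl

theorem linearConst_congr {k : ℕ} {y z : G.NT → ℕ → MvPowerSeries T (CollapsedNat k)} {e : ℕ}
    (h : ∀ X m, m < e → y X m = z X m) (X : G.NT) :
    linearConst G y e X = linearConst G z e X := by
  refine Finset.sum_congr rfl fun r _ => congrArg _ (Finset.sum_congr rfl fun δ hδ => ?_)
  split_ifs with hj
  · exact Finset.prod_congr rfl fun i hi => h _ _ (hj i)
  · rfl

theorem isRationalSeries_linearCoeff {k : ℕ} {y : G.NT → ℕ → MvPowerSeries T (CollapsedNat k)}
    {e : ℕ} (h : ∀ X m, m < e → IsRationalSeries (y X m)) (X Y : G.NT) :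
    IsRationalSeries (linearCoeff G y e X Y) := by
  refine .sum _ fun r _ => (IsRationalSeries.monom _).mul (.sum _ fun δ hδ => .sum _ fun j _ => ?_)
  split_ifs with hj
  · exact .prod _ fun i hi =>
      h _ _ (lt_of_strahler (mem_strahlerFiber.1 hδ) hj.1 (Finset.ne_of_mem_erase hi))
  · exact .zero

theorem isRationalSeries_linearConst {k : ℕ} {y : G.NT → ℕ → MvPowerSeries T (CollapsedNat k)}
    {e : ℕ} (h : ∀ X m, m < e → IsRationalSeries (y X m)) (X : G.NT) :
    IsRationalSeries (linearConst G y e X) := by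
  refine .sum _ fun r _ => (IsRationalSeries.monom _).mul (.sum _ fun δ hδ => ?_)
  split_ifs with hj
  · exact .prod _ fun i _ => h _ _ (hj i)
  · exact .zero

/-- The largest series in `ℕ_k⟨⟨ℕ^T⟩⟩`. -/
def topSeries (T : Type*) (k : ℕ) : MvPowerSeries T (CollapsedNat k) :=
  fun _ => CollapsedNat.ofNat k k

theorem naturalLE_topSeries {k : ℕ} (a : MvPowerSeries T (CollapsedNat k)) :
    NaturalLE a (topSeries T k) :=
  naturalLE_iff_val_le.2 fun v => (a v).2.trans (min_self k).ge

theorem isRationalSeries_dimSeries [Fintype G.NT] (k e : ℕ) (X : G.NT) :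
    IsRationalSeries (dimSeries k G X e) := by
  induction e using Nat.strong_induction_on generalizing X with
  | _ e ih =>
    obtain ⟨x, hx, hx1, hx2⟩ := exists_rational_least_solution
      (linearCoeff G (dimSeries k G) e) (linearConst G (dimSeries k G) e)
      (isRationalSeries_linearCoeff fun X m hm => ih m hm X)
      (isRationalSeries_linearConst fun X m hm => ih m hm X)
    -- Leastness of `dimSeries` concerns the system for all dimensions at once. Filling in the top
    -- series above `e` makes those inequalities trivial, and the equations up to `e` never refer to
    -- them.
    let y : G.NT → ℕ → MvPowerSeries T (CollapsedNat k) := fun X m =>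
      if m < e then dimSeries k G X m else if m = e then x X else topSeries T k
    have hylt : ∀ X m, m < e → y X m = dimSeries k G X m := fun X m hm => if_pos hm
    have hye : ∀ X, y X e = x X := fun X => by simp [y]
    have hle : NaturalLE (dimSeries k G X e) (y X e) := by
      refine dimSeries_naturalLE k y (fun X q => ?_) X e
      rcases lt_trichotomy q e with hq | rfl | hq
      · have hcongr : ruleSum G X (fun r => strahlerFiber (varsOf r.output).length q) y =
            ruleSum G X (fun r => strahlerFiber (varsOf r.output).length q) (dimSeries k G) :=
          ruleSum_congr fun r δ hδ i =>
            hylt _ _ (((le_strahler δ i).trans (mem_strahlerFiber.1 hδ).le).trans_lt hq)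
        rw [hcongr, hylt X q hq, ← dimSeries_eq_ruleSum]
        exact NaturalLE.refl _
      · rw [ruleSum_eq_linear, hye]
        simp only [hye, linearCoeff_congr hylt, linearConst_congr hylt]
        exact hx1 X
      · have : y X q = topSeries T k := by
          simp only [y, if_neg hq.not_gt, if_neg hq.ne']
        rw [this]
        exact naturalLE_topSeries _
    rw [hye] at hle
    have hge : NaturalLE (x X) (dimSeries k G X e) := by
      refine hx2 (fun X => dimSeries k G X e) (fun X => ?_) X
      rw [← ruleSum_eq_linear, ← dimSeries_eq_ruleSum]
      exact NaturalLE.refl _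
    rw [hle.antisymm hge]
    exact hx X

end dimSeries

/-! ### Commutative ambiguity as a least solution -/

section camb

variable {T : Type*}

/-- The right-hand side for `X` of the polynomial system of a set of context-free rules. -/
def polySum {N R : Type*} [CommSemiring R] (P : Finset (ContextFreeRule T N)) (X : N)
    (y : N → MvPowerSeries T R) : MvPowerSeries T R :=
  ∑ r ∈ P.filter (fun r => r.input = X),
    MvPowerSeries.monomial (terminalParikh r.output) 1 * ((varsOf r.output).map y).prod

theorem ruleSum_unit {R : Type*} [CommSemiring R] (G : ContextFreeGrammar T) (X : G.NT)
    (y : G.NT → Unit → MvPowerSeries T R) :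
    ruleSum G X (fun _ => {fun _ => ()}) y = polySum G.rules X fun Y => y Y () := by
  refine Finset.sum_congr rfl fun r _ => ?_
  rw [Finset.sum_singleton, ← Fin.prod_univ_fun_getElem]
  rfl

theorem cambMod_eq_polySum (k : ℕ) (G : ContextFreeGrammar T) (X : G.NT) :
    cambMod k G X = polySum G.rules X (cambMod k G) := by
  have h := treeSeries_eq_ruleSum (G := G) (Q := Unit) k (fun _ => {fun _ => ()})
    (fun _ => Set.univ) (fun _ _ => Set.univ) (by simp) (by simp) X
  rw [ruleSum_unit] at h
  simp only [← cambMod_eq_treeSeries] at h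
  exact h

theorem cambMod_naturalLE (k : ℕ) (G : ContextFreeGrammar T)
    (y : G.NT → MvPowerSeries T (CollapsedNat k))
    (hy : ∀ X, NaturalLE (polySum G.rules X y) (y X)) (X : G.NT) :
    NaturalLE (cambMod k G X) (y X) := by
  rw [cambMod_eq_treeSeries]
  refine treeSeries_naturalLE (Q := Unit) k (fun _ _ => {fun _ => ()}) (fun _ _ => Set.univ)
    (by simp) (by simp) (fun Y _ => y Y) (fun X _ => ?_) X ()
  rw [ruleSum_unit]
  exact hy X

end camb

/-! ### Relabelled sentential forms -/

section relabel

variable {T N N' : Type*}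

theorem terminalParikh_relabel (γ : List (Symbol T N)) (Z : Fin (varsOf γ).length → N') :
    terminalParikh (relabel γ Z) = terminalParikh γ := by
  induction γ with
  | nil => rfl
  | cons s γ ih =>
    cases s with
    | terminal a => exact congrArg _ (ih Z)
    | nonterminal X => exact ih fun i => Z i.succ

theorem varsOf_relabel (γ : List (Symbol T N)) (Z : Fin (varsOf γ).length → N') :
    varsOf (relabel γ Z) = List.ofFn Z := by
  induction γ with
  | nil => rfl
  | cons s γ ih =>
    cases s with
    | terminal a => exact ih Z
    | nonterminal X =>
      have h : List.ofFn Z = Z ⟨0, Nat.succ_pos _⟩ ::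
          List.ofFn (n := (varsOf γ).length) fun i => Z i.succ :=
        List.ofFn_succ (n := (varsOf γ).length) (f := Z)
      rw [h, ← ih]
      rfl

/-- The action of a map of variables on symbols. -/
def mapSymbol (g : N' → N) : Symbol T N' → Symbol T N
  | .terminal a => .terminal a
  | .nonterminal Z => .nonterminal (g Z)

/-- Forgetting the indices recovers the original right-hand side, so different rules never unfold to
the same rule. -/
theorem map_relabel (g : N' → N) (γ : List (Symbol T N)) (Z : Fin (varsOf γ).length → N')
    (h : ∀ i, g (Z i) = (varsOf γ).get i) : (relabel γ Z).map (mapSymbol g) = γ := by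
  induction γ with
  | nil => rfl
  | cons s γ ih =>
    cases s with
    | terminal a => exact congrArg (Symbol.terminal a :: ·) (ih Z h)
    | nonterminal X =>
      have h0 : g (Z ⟨0, Nat.succ_pos _⟩) = X := h ⟨0, Nat.succ_pos _⟩
      exact congrArg₂ (Symbol.nonterminal · :: ·) h0 (ih _ fun i => h i.succ)

end relabel

/-! ### The patterns of the unfolded rules -/

section patterns

variable {N : Type} {d : ℕ}

/-- The variable of the original grammar. -/
def UnfoldVar.base : UnfoldVar N d → N
  | .atMost X _ => X
  | .exactly X _ => X

/-- The dimensions of the trees that a variable of the unfolding stands for. -/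
def UnfoldVar.dims : UnfoldVar N d → Finset ℕ
  | .atMost _ e => Finset.range (e + 1)
  | .exactly _ e => {(e : ℕ)}

/-- The number `m` as an index of a variable of the unfolding. -/
abbrev toIndex (d m : ℕ) : Fin (d + 1) := Fin.ofNat (d + 1) m

theorem val_toIndex {m : ℕ} (h : m ≤ d) : (toIndex d m : ℕ) = m :=
  Nat.mod_eq_of_lt (Nat.lt_succ_of_le h)

theorem toIndex_val (e : Fin (d + 1)) : toIndex d e = e :=
  Fin.ext (val_toIndex (Nat.le_of_lt_succ e.2))

/-- The variables of the children of a node of dimension `e` whose children have the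
dimensions `δ i`. -/
def unfoldPattern {n : ℕ} (d : ℕ) (V : Fin n → N) (e : ℕ) (δ : Fin n → ℕ) (i : Fin n) :
    UnfoldVar N d :=
  if ∃ j, δ j = e then
    if δ i = e then .exactly (V i) (toIndex d e) else .atMost (V i) (toIndex d (e - 1))
  else
    if δ i + 1 = e then .exactly (V i) (toIndex d (e - 1)) else .atMost (V i) (toIndex d (e - 2))

theorem base_unfoldPattern {n : ℕ} (V : Fin n → N) (e : ℕ) (δ : Fin n → ℕ) (i : Fin n) :
    (unfoldPattern d V e δ i).base = V i := by
  unfold unfoldPattern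
  split_ifs <;> rfl

theorem mem_dims_unfoldPattern {n : ℕ} (V : Fin n → N) {e : ℕ} (he : e ≤ d) {δ : Fin n → ℕ}
    (hδ : strahler δ = e) (i : Fin n) : δ i ∈ (unfoldPattern d V e δ i).dims := by
  have hi : δ i ≤ e := hδ ▸ le_strahler δ i
  unfold unfoldPattern
  split_ifs with h1 h2 h2
  · simp only [UnfoldVar.dims, Finset.mem_singleton, val_toIndex he, h2]
  · simp only [UnfoldVar.dims, Finset.mem_range, val_toIndex (show e - 1 ≤ d by omega)]
    omega
  · simp only [UnfoldVar.dims, Finset.mem_singleton, val_toIndex (show e - 1 ≤ d by omega)]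
    omega
  · have h3 : δ i ≠ e := fun h => h1 ⟨i, h⟩
    simp only [UnfoldVar.dims, Finset.mem_range, val_toIndex (show e - 2 ≤ d by omega)]
    omega

theorem strahler_eq_of_unique_max {n e : ℕ} {δ : Fin n → ℕ} {j : Fin n} (hj : δ j = e)
    (h : ∀ i, i ≠ j → δ i < e) : strahler δ = e := by
  refine le_antisymm ((strahler_le_iff δ e).2 ⟨fun i => ?_, fun a b ha hb => ?_⟩)
    (hj ▸ le_strahler δ j)
  · by_cases hi : i = j
    · rw [hi, hj]
    · exact (h i hi).le
  · have ha' : a = j := by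
      by_contra hne
      exact (h a hne).ne ha
    have hb' : b = j := by
      by_contra hne
      exact (h b hne).ne hb
    rw [ha', hb']

theorem strahler_eq_of_two_max {n e : ℕ} {δ : Fin n → ℕ} {i j : Fin n} (hij : i ≠ j)
    (hi : δ i + 1 = e) (hj : δ j + 1 = e) (h : ∀ l, δ l < e) : strahler δ = e := by
  refine le_antisymm ((strahler_le_iff δ e).2 ⟨fun l => (h l).le, fun a b ha => ?_⟩) ?_
  · exact absurd ha (h a).ne
  · by_contra hlt
    exact hij (((strahler_le_iff δ (e - 1)).1 (by omega)).2 i j (by omega) (by omega))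

theorem exists_two_max {n e : ℕ} {δ : Fin n → ℕ} (hδ : strahler δ = e) (h : ∀ j, δ j ≠ e)
    (he : 0 < e) : (∀ l, δ l < e) ∧ ∃ i j, i ≠ j ∧ δ i + 1 = e ∧ δ j + 1 = e := by
  have hlt : ∀ l, δ l < e := fun l => (hδ ▸ le_strahler δ l).lt_of_ne (h l)
  refine ⟨hlt, ?_⟩
  by_contra hcon
  push Not at hcon
  have : strahler δ ≤ e - 1 := by
    refine (strahler_le_iff δ (e - 1)).2 ⟨fun i => Nat.le_sub_one_of_lt (hlt i),
      fun i j hi hj => ?_⟩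
    by_contra hij
    exact hcon i j hij (by omega) (by omega)
  omega

theorem eq_zero_of_strahler_eq_zero {n : ℕ} {δ : Fin n → ℕ} (hδ : strahler δ = 0)
    (h : ∀ j, δ j ≠ 0) : n = 0 := by
  by_contra hn
  have := (hδ ▸ le_strahler δ ⟨0, Nat.pos_of_ne_zero hn⟩)
  exact h _ (Nat.le_zero.1 this)

/-- The patterns partition the families of Strahler number `e`: the families admitted by a pattern
are exactly those that produce it. Hence the unfolding counts nothing twice. -/
theorem mem_dims_unfoldPattern_iff {n : ℕ} (V : Fin n → N) {e : ℕ} (he : e ≤ d) {δ : Fin n → ℕ}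
    (hδ : strahler δ = e) (δ' : Fin n → ℕ) :
    (∀ i, δ' i ∈ (unfoldPattern d V e δ i).dims) ↔
      strahler δ' = e ∧ unfoldPattern d V e δ' = unfoldPattern d V e δ := by
  constructor
  swap
  · rintro ⟨h1, h2⟩ i
    rw [← h2]
    exact mem_dims_unfoldPattern V he h1 i
  intro h
  have h1 : e - 1 ≤ d := by omega
  have h2 : e - 2 ≤ d := by omega
  by_cases hex : ∃ j, δ j = e
  · have hex0 := hex
    obtain ⟨j, hj⟩ := hex
    have hj' : δ' j = e := by
      have := h j
      simpa only [unfoldPattern, if_pos hex0, if_pos hj, UnfoldVar.dims,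
        Finset.mem_singleton, val_toIndex he] using this
    have hlt : ∀ i, i ≠ j → δ' i < e := by
      intro i hij
      have h3 := lt_of_strahler hδ hj hij
      have h4 := h i
      simp only [unfoldPattern, if_pos hex0, if_neg h3.ne, UnfoldVar.dims,
        Finset.mem_range, val_toIndex h1] at h4
      omega
    have hex' : ∃ j, δ' j = e := ⟨j, hj'⟩
    refine ⟨strahler_eq_of_unique_max hj' hlt, funext fun i => ?_⟩
    have hiff : δ' i = e ↔ δ i = e := by
      by_cases hij : i = j
      · subst hij
        simp only [hj, hj']
      · simp only [(hlt i hij).ne, (lt_of_strahler hδ hj hij).ne]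
    simp only [unfoldPattern, if_pos hex0, if_pos hex', hiff]
  · push Not at hex
    -- For `e = 0` with no child of dimension `0` there are no children at all; otherwise two
    -- children have dimension `e - 1`.
    rcases Nat.eq_zero_or_pos e with he0 | hpos
    · subst he0
      obtain rfl := eq_zero_of_strahler_eq_zero hδ hex
      obtain rfl : δ' = δ := Subsingleton.elim _ _
      exact ⟨hδ, rfl⟩
    obtain ⟨hlt, i, j, hij, hi, hj⟩ := exists_two_max hδ hex hpos
    have hne : ¬ ∃ j, δ j = e := by
      push Not
      exact hex
    have heq : ∀ l, δ l + 1 = e → δ' l + 1 = e := by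
      intro l hl
      have h3 := h l
      simp only [unfoldPattern, if_neg hne, if_pos hl, UnfoldVar.dims, Finset.mem_singleton,
        val_toIndex h1] at h3
      omega
    have hlt2 : ∀ l, δ l + 1 ≠ e → δ' l + 1 < e := by
      intro l hl
      have h3 := h l
      have h4 := hlt l
      simp only [unfoldPattern, if_neg hne, if_neg hl, UnfoldVar.dims, Finset.mem_range,
        val_toIndex h2] at h3
      omega
    have hlt' : ∀ l, δ' l < e := by
      intro l
      by_cases hl : δ l + 1 = e
      · have := heq l hl; omega
      · have := hlt2 l hl; omega
    have hne' : ¬ ∃ j, δ' j = e := by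
      rintro ⟨l, hl⟩
      exact (hlt' l).ne hl
    refine ⟨strahler_eq_of_two_max hij (heq i hi) (heq j hj) hlt', funext fun l => ?_⟩
    have hiff : δ' l + 1 = e ↔ δ l + 1 = e := by
      refine ⟨fun h3 => ?_, heq l⟩
      by_contra hl
      exact (hlt2 l hl).ne h3
    simp only [unfoldPattern, if_neg hne, if_neg hne', hiff]

end patterns

/-! ### The rules of the unfolding -/

section rules

variable {T : Type*} {N : Type} {P : Finset (ContextFreeRule T N)} {d : ℕ}

theorem unfoldRule_atMost_iff {X : N} {e : Fin (d + 1)} {out : List (Symbol T (UnfoldVar N d))} :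
    UnfoldRule P d ⟨.atMost X e, out⟩ ↔
      ∃ e', e' ≤ e ∧ out = [Symbol.nonterminal (.exactly X e')] := by
  constructor
  · intro h
    generalize hs : (⟨.atMost X e, out⟩ : ContextFreeRule T (UnfoldVar N d)) = s at h
    cases h with
    | choose Y d' e' h =>
      simp only [ContextFreeRule.mk.injEq, UnfoldVar.atMost.injEq] at hs
      obtain ⟨⟨rfl, rfl⟩, rfl⟩ := hs
      exact ⟨e', h, rfl⟩
    | leaf r hr h => simp at hs
    | unary r hr h => simp at hs
    | single r hr h => simp at hs
    | multi r hr h => simp at hs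
  · rintro ⟨e', h, rfl⟩
    exact .choose X e e' h

theorem unfoldRule_exactly_of_strahler {r : ContextFreeRule T N} (hr : r ∈ P) {e : Fin (d + 1)}
    {δ : Fin (varsOf r.output).length → ℕ} (hδ : strahler δ = e) :
    UnfoldRule P d ⟨.exactly r.input e,
      relabel r.output (unfoldPattern d (varsOf r.output).get e δ)⟩ := by
  have hed : (e : ℕ) ≤ d := Nat.le_of_lt_succ e.2
  rcases Nat.lt_trichotomy (varsOf r.output).length 1 with hn | hn | hn
  · have hn0 : (varsOf r.output).length = 0 := by omega
    have he0 : e = 0 := by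
      apply Fin.ext
      rw [← hδ]
      refine Nat.le_zero.1 ((strahler_le_iff δ 0).2 ⟨fun i => ?_, fun i => ?_⟩)
      · exact absurd i.2 (by omega)
      · exact absurd i.2 (by omega)
    subst he0
    have hZ : unfoldPattern d (varsOf r.output).get ((0 : Fin (d + 1)) : ℕ) δ =
        fun i => .exactly ((varsOf r.output).get i) 0 :=
      funext fun i => absurd i.2 (by omega)
    rw [hZ]
    exact .leaf r hr hn0
  · have hall : ∀ i, δ i = e := by
      intro i
      refine le_antisymm (hδ ▸ le_strahler δ i) ?_
      rw [← hδ]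
      refine (strahler_le_iff δ _).2 ⟨fun j => ?_, fun a b _ _ => Fin.ext (by omega)⟩
      rw [show j = i from Fin.ext (by omega)]
    have hZ : unfoldPattern d (varsOf r.output).get e δ =
        fun i => .exactly ((varsOf r.output).get i) e := by
      funext i
      rw [unfoldPattern, if_pos ⟨i, hall i⟩, if_pos (hall i), toIndex_val]
    rw [hZ]
    exact .unary r hr hn e
  · by_cases hex : ∃ j, δ j = e
    · obtain ⟨j, hj⟩ := hex
      obtain ⟨l, hl⟩ : ∃ l, l ≠ j := by
        have : Nontrivial (Fin (varsOf r.output).length) := Fin.nontrivial_iff_two_le.2 hn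
        exact exists_ne j
      have hpos := lt_of_strahler hδ hj hl
      have hv : (toIndex d ((e : ℕ) - 1) : ℕ) = e - 1 := val_toIndex (by omega)
      have hZ : unfoldPattern d (varsOf r.output).get e δ = fun i =>
          if i = j then .exactly ((varsOf r.output).get i) e
          else .atMost ((varsOf r.output).get i) (toIndex d ((e : ℕ) - 1)) := by
        funext i
        rw [unfoldPattern, if_pos ⟨j, hj⟩, toIndex_val]
        by_cases hij : i = j
        · rw [if_pos hij, if_pos (by rw [hij, hj])]
        · rw [if_neg hij, if_neg (lt_of_strahler hδ hj hij).ne]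
      rw [hZ]
      convert UnfoldRule.single r hr hn e (toIndex d ((e : ℕ) - 1)) (by omega) j
    · have hne : ∀ j, δ j ≠ e := fun j hj => hex ⟨j, hj⟩
      have hpos : 0 < (e : ℕ) := by
        by_contra h0
        have h1 : strahler δ = 0 := by omega
        have := eq_zero_of_strahler_eq_zero h1 fun j hj => hne j (by omega)
        omega
      obtain ⟨hlt, a, b, hab, ha, hb⟩ := exists_two_max hδ hne hpos
      refine .multi r hr hn e (Finset.univ.filter fun i => δ i + 1 = e) ?_ _ ?_ ?_
      · exact Finset.one_lt_card.2 ⟨a, by simpa using ha, b, by simpa using hb, hab⟩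
      · intro i hi
        have hi' : δ i + 1 = e := by simpa using hi
        refine ⟨toIndex d ((e : ℕ) - 1), ?_, ?_⟩
        · rw [val_toIndex (by omega)]
          omega
        · rw [unfoldPattern, if_neg hex, if_pos hi']
      · intro i hi
        have hi' : δ i + 1 ≠ e := by simpa using hi
        have := hlt i
        refine ⟨toIndex d ((e : ℕ) - 2), ?_, ?_⟩
        · rw [val_toIndex (by omega)]
          omega
        · rw [unfoldPattern, if_neg hex, if_neg hi']

/-- The kinds of rules for `X^{= e}` mirror the ways in which a Strahler number `e` arises: no
child, one child, a unique child at `e`, or at least two maximal children at `e - 1`. -/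
theorem unfoldRule_exactly_iff {X : N} {e : Fin (d + 1)} {out : List (Symbol T (UnfoldVar N d))} :
    UnfoldRule P d ⟨.exactly X e, out⟩ ↔
      ∃ r ∈ P, r.input = X ∧ ∃ δ : Fin (varsOf r.output).length → ℕ, strahler δ = e ∧
        out = relabel r.output (unfoldPattern d (varsOf r.output).get e δ) := by
  constructor
  swap
  · rintro ⟨r, hr, rfl, δ, hδ, rfl⟩
    exact unfoldRule_exactly_of_strahler hr hδ
  intro h
  generalize hs : (⟨.exactly X e, out⟩ : ContextFreeRule T (UnfoldVar N d)) = s at h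
  cases h with
  | choose Y d' e' h => simp at hs
  | leaf r hr h =>
    simp only [ContextFreeRule.mk.injEq, UnfoldVar.exactly.injEq] at hs
    obtain ⟨⟨rfl, rfl⟩, rfl⟩ := hs
    refine ⟨r, hr, rfl, fun _ => 0, ?_, congrArg _ (funext fun i => absurd i.2 (by omega))⟩
    refine Nat.le_zero.1 ((strahler_le_iff _ 0).2 ⟨fun i => le_rfl, fun i => ?_⟩)
    exact absurd i.2 (by omega)
  | unary r hr h d' =>
    simp only [ContextFreeRule.mk.injEq, UnfoldVar.exactly.injEq] at hs
    obtain ⟨⟨rfl, rfl⟩, rfl⟩ := hs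
    refine ⟨r, hr, rfl, fun _ => e, ?_, congrArg _ (funext fun i => ?_)⟩
    · exact strahler_eq_of_unique_max (j := ⟨0, by omega⟩) rfl fun i hi =>
        absurd (Fin.ext (by simp only; omega)) hi
    · rw [unfoldPattern, if_pos ⟨i, rfl⟩, if_pos rfl, toIndex_val]
  | single r hr h d' e' hd j =>
    simp only [ContextFreeRule.mk.injEq, UnfoldVar.exactly.injEq] at hs
    obtain ⟨⟨rfl, rfl⟩, rfl⟩ := hs
    -- Any values below `e` away from `j` give the same pattern; `0` is below `e` because `e ≥ 1`
    -- here.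
    refine ⟨r, hr, rfl, fun i => if i = j then e else 0, ?_, congrArg _ (funext fun i => ?_)⟩
    · refine strahler_eq_of_unique_max (j := j) (if_pos rfl) fun i hi => ?_
      rw [if_neg hi]
      omega
    · have hex : ∃ l, (fun i => if i = j then (e : ℕ) else 0) l = e := ⟨j, if_pos rfl⟩
      rw [unfoldPattern, if_pos hex, toIndex_val]
      by_cases hij : i = j
      · simp only [if_pos hij, if_true]
      · have hne : ¬ (if i = j then (e : ℕ) else 0) = e := by
          rw [if_neg hij]
          omega
        rw [if_neg hij, if_neg hne, ← hd, Nat.add_sub_cancel, toIndex_val]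
  | multi r hr h d' J hJ Z hZ hZ' =>
    simp only [ContextFreeRule.mk.injEq, UnfoldVar.exactly.injEq] at hs
    obtain ⟨⟨rfl, rfl⟩, rfl⟩ := hs
    obtain ⟨a, ha, b, hb, hab⟩ := Finset.one_lt_card.1 hJ
    obtain ⟨e₁, he₁, -⟩ := hZ a ha
    have hlt : ∀ i, (if i ∈ J then (e : ℕ) - 1 else 0) < e := fun i => by
      split_ifs <;> omega
    refine ⟨r, hr, rfl, fun i => if i ∈ J then (e : ℕ) - 1 else 0, ?_,
      congrArg _ (funext fun i => ?_)⟩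
    · refine strahler_eq_of_two_max hab ?_ ?_ hlt
      · rw [if_pos ha]; omega
      · rw [if_pos hb]; omega
    · rw [unfoldPattern, if_neg (by rintro ⟨l, hl⟩; exact (hlt l).ne hl)]
      by_cases hi : i ∈ J
      · obtain ⟨e', he', hZi⟩ := hZ i hi
        rw [if_pos (by rw [if_pos hi]; omega), hZi, ← he', Nat.add_sub_cancel, toIndex_val]
      -- An index outside `J` forces `e ≥ 2`, so the chosen value `0` differs from `e - 1`.
      · obtain ⟨e', he', hZi⟩ := hZ' i hi
        rw [if_neg (by rw [if_neg hi]; omega), hZi, ← he', Nat.add_sub_cancel, toIndex_val]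

end rules

/-! ### The polynomial system of the unfolding -/

section unfolding

variable {T : Type*} {N : Type} {d : ℕ}

/-- The series of the variables of the unfolding, given the series for the exact dimensions. -/
def unfoldValue {R : Type*} [CommSemiring R] (y : N → ℕ → MvPowerSeries T R) (Z : UnfoldVar N d) :
    MvPowerSeries T R :=
  ∑ m ∈ Z.dims, y Z.base m

theorem unfoldValue_exactly {R : Type*} [CommSemiring R] (y : N → ℕ → MvPowerSeries T R) (X : N)
    (e : Fin (d + 1)) : unfoldValue y (.exactly X e) = y X e :=
  Finset.sum_singleton _ _

theorem unfoldValue_atMost {R : Type*} [CommSemiring R] (y : N → ℕ → MvPowerSeries T R) (X : N)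
    (e : Fin (d + 1)) : unfoldValue y (.atMost X e) = ∑ e' ∈ Finset.Iic e, y X e' := by
  rw [unfoldValue]
  simp only [UnfoldVar.dims, UnfoldVar.base]
  rw [Nat.range_succ_eq_Iic, ← Fin.map_valEmbedding_Iic, Finset.sum_map]
  rfl

/-- The rules of the unfolding of a set of context-free rules. -/
abbrev unfoldRules [Finite N] (P : Finset (ContextFreeRule T N)) (d : ℕ) :
    Finset (ContextFreeRule T (UnfoldVar N d)) :=
  (finite_setOf_unfoldRule P d).toFinset

theorem polySum_atMost [Finite N] {R : Type*} [CommSemiring R] (P : Finset (ContextFreeRule T N))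
    (X : N) (e : Fin (d + 1)) (y : UnfoldVar N d → MvPowerSeries T R) :
    polySum (unfoldRules P d) (.atMost X e) y = ∑ e' ∈ Finset.Iic e, y (.exactly X e') := by
  have h : (unfoldRules P d).filter (fun s => s.input = .atMost X e) =
      (Finset.Iic e).image fun e' => ⟨.atMost X e, [Symbol.nonterminal (.exactly X e')]⟩ := by
    ext s
    simp only [Finset.mem_filter, Set.Finite.mem_toFinset, Set.mem_ofPred_eq, Finset.mem_image,
      Finset.mem_Iic]
    constructor
    · rintro ⟨h1, h2⟩
      obtain ⟨Z, out⟩ := s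
      obtain rfl : Z = .atMost X e := h2
      obtain ⟨e', he', rfl⟩ := unfoldRule_atMost_iff.1 h1
      exact ⟨e', he', rfl⟩
    · rintro ⟨e', he', rfl⟩
      exact ⟨unfoldRule_atMost_iff.2 ⟨e', he', rfl⟩, rfl⟩
  rw [polySum, h, Finset.sum_image]
  · refine Finset.sum_congr rfl fun e' _ => ?_
    change MvPowerSeries.monomial 0 1 * ([y (.exactly X e')].prod) = _
    rw [List.prod_singleton, MvPowerSeries.monomial_zero_one, one_mul]
  · intro a _ b _ hab
    simpa using hab

theorem polySum_exactly [Finite N] {R : Type*} [CommSemiring R] (P : Finset (ContextFreeRule T N))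
    (X : N) (e : Fin (d + 1)) (y : N → ℕ → MvPowerSeries T R) :
    polySum (unfoldRules P d) (.exactly X e) (unfoldValue y) =
      ∑ r ∈ P.filter (fun r => r.input = X),
        MvPowerSeries.monomial (terminalParikh r.output) 1 *
          ∑ δ ∈ strahlerFiber (varsOf r.output).length e,
            ∏ i, y ((varsOf r.output).get i) (δ i) := by
  have hed : (e : ℕ) ≤ d := Nat.le_of_lt_succ e.2
  let pats : ∀ r : ContextFreeRule T N, Finset (Fin (varsOf r.output).length → UnfoldVar N d) :=
    fun r => (strahlerFiber (varsOf r.output).length e).image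
      (unfoldPattern d (varsOf r.output).get e)
  have hbase : ∀ (r : ContextFreeRule T N), ∀ Z ∈ pats r, ∀ i,
      (Z i).base = (varsOf r.output).get i := by
    intro r Z hZ i
    obtain ⟨δ, -, rfl⟩ := Finset.mem_image.1 hZ
    exact base_unfoldPattern _ _ _ _
  have h : (unfoldRules P d).filter (fun s => s.input = .exactly X e) =
      (P.filter (fun r => r.input = X)).biUnion fun r =>
        (pats r).image fun Z => ⟨.exactly X e, relabel r.output Z⟩ := by
    ext s
    simp only [Finset.mem_filter, Set.Finite.mem_toFinset, Set.mem_ofPred_eq, Finset.mem_image,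
      Finset.mem_biUnion, pats, mem_strahlerFiber]
    constructor
    · rintro ⟨h1, h2⟩
      obtain ⟨Z, out⟩ := s
      obtain rfl : Z = .exactly X e := h2
      obtain ⟨r, hr, hX, δ, hδ, rfl⟩ := unfoldRule_exactly_iff.1 h1
      exact ⟨r, ⟨hr, hX⟩, _, ⟨δ, hδ, rfl⟩, rfl⟩
    · rintro ⟨r, ⟨hr, hX⟩, _, ⟨δ, hδ, rfl⟩, rfl⟩
      exact ⟨unfoldRule_exactly_iff.2 ⟨r, hr, hX, δ, hδ, rfl⟩, rfl⟩
  rw [polySum, h, Finset.sum_biUnion]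
  · refine Finset.sum_congr rfl fun r _ => ?_
    rw [Finset.sum_image, Finset.mul_sum,
      ← Finset.sum_fiberwise_of_maps_to (g := unfoldPattern d (varsOf r.output).get e)
        (t := pats r) fun δ hδ => Finset.mem_image_of_mem _ hδ]
    · refine Finset.sum_congr rfl fun Z hZ => ?_
      rw [terminalParikh_relabel, varsOf_relabel, List.map_ofFn, List.prod_ofFn, ← Finset.mul_sum]
      congr 1
      have h1 : ∏ i, (unfoldValue y ∘ Z) i =
          ∏ i, ∑ m ∈ (Z i).dims, y ((varsOf r.output).get i) m :=
        Finset.prod_congr rfl fun i _ => by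
          rw [Function.comp_apply, unfoldValue, hbase r Z hZ i]
      -- Expanding the product sums over the families that fit the pattern `Z`, which form one fibre
      -- of `unfoldPattern`.
      rw [h1, Finset.prod_univ_sum]
      refine Finset.sum_congr ?_ fun _ _ => rfl
      obtain ⟨δ, hδ, rfl⟩ := Finset.mem_image.1 hZ
      ext δ'
      rw [Fintype.mem_piFinset, mem_dims_unfoldPattern_iff _ hed (mem_strahlerFiber.1 hδ),
        Finset.mem_filter, mem_strahlerFiber]
    · intro Z _ Z' _ hZZ
      have h1 := congrArg varsOf (congrArg ContextFreeRule.output hZZ)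
      simp only [varsOf_relabel] at h1
      exact List.ofFn_injective h1
  · intro r hr r' hr' hrr
    rw [Function.onFun, Finset.disjoint_left]
    intro s hs hs'
    obtain ⟨Z, hZ, rfl⟩ := Finset.mem_image.1 hs
    obtain ⟨Z', hZ', hZZ⟩ := Finset.mem_image.1 hs'
    -- The unfolded rules form a set, so coinciding images of different rules would be counted only
    -- once; erasing the indices excludes this.
    have h1 := congrArg (List.map (mapSymbol UnfoldVar.base))
      (congrArg ContextFreeRule.output hZZ)
    simp only [map_relabel _ _ _ (hbase r Z hZ), map_relabel _ _ _ (hbase r' Z' hZ')] at h1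
    have h2 := (Finset.mem_filter.1 hr).2
    have h3 := (Finset.mem_filter.1 hr').2
    apply hrr
    cases r
    cases r'
    simp only at h1 h2 h3
    rw [h1, h2, h3]

/-- No bijection of trees is needed. Each side solves the system of which the other is the least
solution, by `polySum_exactly` and `polySum_atMost`. -/
theorem cambMod_unfoldGrammar (k : ℕ) (G : ContextFreeGrammar T) [Finite G.NT]
    (Z : UnfoldVar G.NT d) :
    cambMod k (unfoldGrammar G d) Z = unfoldValue (dimSeries k G) Z := by
  apply NaturalLE.antisymm
  · refine cambMod_naturalLE k (unfoldGrammar G d) (unfoldValue (dimSeries k G)) (fun Z => ?_) Z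
    change NaturalLE (polySum (unfoldRules G.rules d) Z _) _
    change UnfoldVar G.NT d at Z
    cases Z with
    | atMost X e =>
      rw [polySum_atMost, unfoldValue_atMost]
      simp only [unfoldValue_exactly]
      exact NaturalLE.refl _
    | exactly X e =>
      rw [polySum_exactly]
      have h := dimSeries_eq_ruleSum k X (e : ℕ)
      rw [ruleSum] at h
      rw [← h, unfoldValue_exactly]
      exact NaturalLE.refl _
  -- The unfolding has no variables for dimensions above `d`; the top series fills them in so that
  -- leastness over all dimensions applies.
  · let y : G.NT → ℕ → MvPowerSeries T (CollapsedNat k) := fun X m =>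
      if h : m < d + 1 then cambMod k (unfoldGrammar G d) (.exactly X ⟨m, h⟩) else topSeries T k
    have hy : ∀ X (e : Fin (d + 1)), y X e = cambMod k (unfoldGrammar G d) (.exactly X e) :=
      fun X e => dif_pos e.2
    have hval : unfoldValue y = cambMod k (unfoldGrammar G d) := by
      funext Z
      cases Z with
      | atMost X e =>
        rw [unfoldValue_atMost]
        simp only [hy]
        exact ((cambMod_eq_polySum k (unfoldGrammar G d) (.atMost X e)).trans
          (polySum_atMost G.rules X e _)).symm
      | exactly X e => rw [unfoldValue_exactly, hy]
    have hle : ∀ X m, NaturalLE (dimSeries k G X m) (y X m) := by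
      refine dimSeries_naturalLE k y fun X m => ?_
      by_cases hm : m < d + 1
      · have h1 := polySum_exactly G.rules X (⟨m, hm⟩ : Fin (d + 1)) y
        rw [hval] at h1
        have h2 := cambMod_eq_polySum k (unfoldGrammar G d) (.exactly X ⟨m, hm⟩)
        rw [ruleSum]
        have h3 : y X m = cambMod k (unfoldGrammar G d) (.exactly X ⟨m, hm⟩) := dif_pos hm
        rw [h3, h2]
        exact h1 ▸ NaturalLE.refl _
      · have h3 : y X m = topSeries T k := dif_neg hm
        rw [h3]
        exact naturalLE_topSeries _
    have h1 : NaturalLE (unfoldValue (dimSeries k G) Z) (unfoldValue y Z) :=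
      NaturalLE.sum _ fun m _ => hle _ m
    rwa [hval] at h1

theorem cambModAtMost_eq (k : ℕ) (G : ContextFreeGrammar T) [Finite G.NT] (X : G.NT) (d : ℕ) :
    cambModAtMost k G X d = ∑ e ∈ Finset.range (d + 1), dimSeries k G X e :=
  cambMod_unfoldGrammar k G (.atMost X (Fin.last d))

theorem le_two_pow_two_pow_logLog (k : ℕ) : k ≤ 2 ^ 2 ^ logLog k := by
  rcases Nat.lt_or_ge k 2 with h | h
  · exact (Nat.le_of_lt_succ h).trans Nat.one_le_two_pow
  have hk1 : (1 : ℝ) < k := by exact_mod_cast h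
  have hlog : 0 < Real.logb 2 k := Real.logb_pos (by norm_num) hk1
  have h1 : Real.logb 2 (Real.logb 2 k) ≤ (logLog k : ℝ) := Nat.le_ceil _
  rw [Real.logb_le_iff_le_rpow (by norm_num) hlog, Real.rpow_natCast] at h1
  rw [Real.logb_le_iff_le_rpow (by norm_num) (by linarith)] at h1
  have h2 : ((2 : ℝ) ^ logLog k) = ((2 ^ logLog k : ℕ) : ℝ) := by push_cast; rfl
  rw [h2, Real.rpow_natCast] at h1
  exact_mod_cast h1

theorem cambMod_eq_treeSeries_dim_le (k : ℕ) (G : ContextFreeGrammar T)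
    [Fintype G.NT] (X : G.NT) :
    cambMod k G X =
      treeSeries k {t : DerivTree G X | t.dim ≤ Fintype.card G.NT + logLog k} := by
  rw [cambMod_eq_treeSeries]
  funext v
  rw [treeSeries_apply, treeSeries_apply]
  -- Either every tree for `v` has small dimension and the counts agree, or one large tree provides
  -- at least `k` small ones and both coefficients saturate at `k`.
  by_cases h : ∀ t : DerivTree G X, t.parikh = v → t.dim ≤ Fintype.card G.NT + logLog k
  · congr 2
    ext t
    simp only [Set.mem_univ, true_and, Set.mem_ofPred_eq]
    exact ⟨fun ht => ⟨h t ht, ht⟩, fun ht => ht.2⟩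
  push Not at h
  obtain ⟨t, rfl, hd⟩ := h
  obtain ⟨g, hg, hg'⟩ := t.hasManyVariants _ hd
  have hmany : (k : ℕ∞) ≤ {s : DerivTree G X |
      s ∈ {s : DerivTree G X | s.dim ≤ Fintype.card G.NT + logLog k} ∧
        s.parikh = t.parikh}.encard := by
    have h1 : (Set.range g).encard = ((2 ^ 2 ^ logLog k : ℕ) : ℕ∞) := by
      rw [← Set.image_univ, hg.encard_image, Set.encard_univ, ENat.card_eq_coe_fintype_card,
        Fintype.card_fin]
    calc (k : ℕ∞) ≤ ((2 ^ 2 ^ logLog k : ℕ) : ℕ∞) :=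
          Nat.cast_le.2 (le_two_pow_two_pow_logLog k)
      _ = (Set.range g).encard := h1.symm
      _ ≤ _ := Set.encard_le_encard ?_
    rintro _ ⟨a, rfl⟩
    refine ⟨(hg' a).2, ?_⟩
    rw [DerivTree.parikh_eq_sum, DerivTree.parikh_eq_sum, (hg' a).1]
  have hfull : ∀ x : ℕ∞, (k : ℕ∞) ≤ x → (CollapsedNat.ofENat k x).1 = k := fun x hx =>
    le_antisymm (CollapsedNat.ofENat k x).2 (CollapsedNat.le_val_ofENat_iff.2 ⟨le_rfl, hx⟩)
  apply Subtype.ext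
  rw [hfull _ hmany]
  exact hfull _ (hmany.trans (Set.encard_le_encard fun s hs => ⟨trivial, hs.2⟩))

end unfolding

end

theorem mainTheorem3 {T : Type*} [Finite T] (G : ContextFreeGrammar T) [Fintype G.NT]
    (X : G.NT) (k : ℕ) (hk : 0 < k) :
    cambModAtMost k G X (Fintype.card G.NT + logLog k) = cambMod k G X ∧
      IsRationalSeries (cambMod k G X) := by
  have h := (cambMod_eq_treeSeries_dim_le k G X).trans (treeSeries_dim_le k X _)
  refine ⟨(cambModAtMost_eq k G X _).trans h.symm, ?_⟩
  rw [h]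
  exact .sum _ fun e _ => isRationalSeries_dimSeries k e X
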